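/- Let $\mathbb{T}=\mathbb{R}/\mathbb{Z}$ and let $p\ge 1$ be an integer. Fix $x_0\in\mathbb{R}$. For a continuous function $f$ on $\mathbb{T}$ (regarded as a $1$-periodic function on $\mathbb{R}$) let $\partial_x^{-1}f$ be the mean-zero periodic primitive of the mean-free part of $f$, that is, with $g=f-\int_{\mathbb{T}}f\,dy$, $$\partial_x^{-1}f(x)=\int_{x_0}^{x}g(y)\,dy-\int_0^1\int_{x_0}^{z}g(y)\,dy\,dz$$ (this does not depend on $x_0$). Consider the Cauchy problem for the modified Hunter–Saxton equation $$\partial_t u+u^p\,\partial_x u=\tfrac12\,\partial_x^{-1}\big(\partial_x(u^p)\,\partial_x u\big),\qquad u(x,0)=u_0(x),\qquad x\in\mathbb{T}. \tag{mHS}$$ Theorem. If $u_0:\mathbb{T}\to\mathbb{R}$ is real-analytic, then there is an $\varepsilon>0$ such that (mHS) has a unique solution $u:\mathbb{T}\times(-\varepsilon,\varepsilon)\to\mathbb{R}$ that is real-analytic in the two variables $(x,t)$ jointly. That is, such a real-analytic solution exists, and any two real-analytic solutions of (mHS) on $\mathbb{T}\times(-\varepsilon,\varepsilon)$ with initial value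 $u_0$ coincide. -/

import Mathlib

/-! Functions on the circle `ℝ / ℤ` are the functions on `ℝ` that are periodic with period `1`;
integration over the circle is integration over `[0, 1]`. -/

noncomputable section

namespace ModifiedHunterSaxton

/-- The component of `f` of mean zero, `f - ∫_𝕋 f`. -/
def meanFree (f : ℝ → ℝ) (x : ℝ) : ℝ :=
  f x - ∫ y in (0 : ℝ)..1, f y

/-- The primitive `x ↦ ∫_{x₀}^x f(y) dy - ∫_𝕋 ∫_{x₀}^z f(y) dy dz` of mean zero. -/
def meanZeroPrimitive (x₀ : ℝ) (f : ℝ → ℝ) (x : ℝ) : ℝ :=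
  (∫ y in x₀..x, f y) - ∫ z in (0 : ℝ)..1, ∫ y in x₀..z, f y

/-- The operator `∂ₓ⁻¹` on continuous functions on the circle: the primitive of mean zero of the
mean-zero component of `f`. Only a function of mean zero has a periodic primitive, so the mean
has to be removed for `∂ₓ⁻¹ f` to be a function on the circle; nothing is removed from an `f` of
mean zero. The result does not depend on the base point `x₀`. -/
def invDeriv (x₀ : ℝ) (f : ℝ → ℝ) : ℝ → ℝ :=
  meanZeroPrimitive x₀ (meanFree f)

/-- The function `(x, t) ↦ u x t` on `𝕋 × (-ε, ε)` is real-analytic in `(x, t)` and solves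
`∂ₜ u + u ^ p ∂ₓ u = (1 / 2) ∂ₓ⁻¹ (∂ₓ (u ^ p) ∂ₓ u)` with `u (x, 0) = u₀ x`.
The values of `u` at times outside `(-ε, ε)` play no role. -/
structure IsAnalyticSolution (p : ℕ) (x₀ : ℝ) (u₀ : ℝ → ℝ) (ε : ℝ) (u : ℝ → ℝ → ℝ) : Prop where
  periodic : ∀ t ∈ Set.Ioo (-ε) ε, Function.Periodic (fun x => u x t) 1
  analytic : AnalyticOnNhd ℝ (fun q : ℝ × ℝ => u q.1 q.2) (Set.univ ×ˢ Set.Ioo (-ε) ε)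
  equation : ∀ x : ℝ, ∀ t ∈ Set.Ioo (-ε) ε,
    deriv (fun τ => u x τ) t + u x t ^ p * deriv (fun y => u y t) x =
      1 / 2 * invDeriv x₀
        (fun y => deriv (fun z => u z t ^ p) y * deriv (fun z => u z t) y) x
  initial : ∀ x : ℝ, u x 0 = u₀ x

end ModifiedHunterSaxton

end

open Set Filter Topology
open scoped ENNReal NNReal PowerSeries ContDiff Nat

namespace ModifiedHunterSaxton

/-! ### The operator `∂ₓ⁻¹` on continuous functions -/

section InvDeriv

variable {f g : ℝ → ℝ}

/-! Existence. Write the equation as `u = u₀ + ∂ₜ⁻¹ F(u)` for power series in `t` whose coefficients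
are smooth periodic functions of `x`. Since `∂ₜ⁻¹` raises the order in `t`, the Picard map contracts
`X`-adically and has a formal fixed point (`formalPicard_formalSolution`). Convergence is the issue,
because `F` contains `∂ₓu`. The norm `seriesNorm` sums the suprema of the space Taylor coefficients
of order `n` of the coefficient of `t ^ k`, weighted by `R ^ n ρ ^ k / binom (n + k, n)`. It is
submultiplicative (`seriesNorm_mul_le`), and `∂ₜ⁻¹∂ₓ` is bounded on it by `ρ / R`
(`seriesNorm_timePrimitive_spaceDeriv_le`): the factor `1 / (k + 1)` from integrating in time,
together with the binomial, pays for the derivative in space.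

Hence `u` and `∂ₓu` are bounded together: in `∂ₓ` of the Picard map the transport term costs `ρ /
R`, and `∂ₓ∂ₓ⁻¹` is only the removal of the mean. For small `ρ` all iterates stay in one ball, and
so does their coefficientwise limit. Cauchy estimates on the compact circle make the norms of `u₀`
and `∂ₓu₀` finite, and a finite norm gives joint analyticity and termwise calculus.

Uniqueness. If the difference `W` of two solutions vanishes to order `k` at `t = 0` for every `x`,
so does `∂ₓW`. Both are then `O(|t| ^ k)` locally uniformly in `x`, and the equation, nonlocal term
included, gives `∂ₜW = O(|t| ^ k)`. So `W` vanishes to order `k + 1`, hence to every order, and is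
zero by analyticity in `t`. -/

lemma continuous_meanFree (hf : Continuous f) : Continuous (meanFree f) :=
  hf.sub continuous_const

lemma continuous_primitive (hf : Continuous f) (x₀ : ℝ) :
    Continuous fun x => ∫ y in x₀..x, f y :=
  intervalIntegral.continuous_primitive (fun a b => hf.intervalIntegrable a b) x₀

lemma invDeriv_apply (x₀ : ℝ) (f : ℝ → ℝ) (x : ℝ) :
    invDeriv x₀ f x =
      (∫ y in x₀..x, meanFree f y) - ∫ z in (0 : ℝ)..1, ∫ y in x₀..z, meanFree f y := rfl

lemma hasDerivAt_invDeriv (hf : Continuous f) (x₀ x : ℝ) :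
    HasDerivAt (invDeriv x₀ f) (meanFree f x) x :=
  ((continuous_meanFree hf).integral_hasStrictDerivAt x₀ x).hasDerivAt.sub_const _

lemma deriv_invDeriv (hf : Continuous f) (x₀ : ℝ) : deriv (invDeriv x₀ f) = meanFree f :=
  funext fun x => (hasDerivAt_invDeriv hf x₀ x).deriv

lemma integral_meanFree (hf : Continuous f) : ∫ y in (0 : ℝ)..1, meanFree f y = 0 := by
  simp [meanFree, intervalIntegral.integral_sub (hf.intervalIntegrable _ _)]

lemma periodic_meanFree (hp : Function.Periodic f 1) : Function.Periodic (meanFree f) 1 :=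
  fun x => by simp [meanFree, hp x]

lemma periodic_invDeriv (hf : Continuous f) (hp : Function.Periodic f 1) (x₀ : ℝ) :
    Function.Periodic (invDeriv x₀ f) 1 := by
  intro x
  have hc := continuous_meanFree hf
  have h1 : ∫ y in x..x + 1, meanFree f y = 0 := by
    rw [(periodic_meanFree hp).intervalIntegral_add_eq x 0, zero_add, integral_meanFree hf]
  rw [invDeriv_apply, invDeriv_apply, ← intervalIntegral.integral_add_adjacent_intervals
    (hc.intervalIntegrable x₀ x) (hc.intervalIntegrable x (x + 1)), h1, add_zero]

lemma meanFree_add (hf : Continuous f) (hg : Continuous g) :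
    meanFree (f + g) = meanFree f + meanFree g := by
  ext x
  simp only [meanFree, Pi.add_apply]
  rw [intervalIntegral.integral_add (hf.intervalIntegrable _ _) (hg.intervalIntegrable _ _)]
  ring

lemma meanFree_smul (c : ℝ) (f : ℝ → ℝ) : meanFree (c • f) = c • meanFree f := by
  ext x
  simp [meanFree, intervalIntegral.integral_const_mul, mul_sub]

lemma invDeriv_add (hf : Continuous f) (hg : Continuous g) (x₀ : ℝ) :
    invDeriv x₀ (f + g) = invDeriv x₀ f + invDeriv x₀ g := by
  ext x
  have hf' := continuous_meanFree hf
  have hg' := continuous_meanFree hg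
  simp only [Pi.add_apply, invDeriv_apply, meanFree_add hf hg,
    intervalIntegral.integral_add (hf'.intervalIntegrable _ _) (hg'.intervalIntegrable _ _)]
  rw [intervalIntegral.integral_add
    ((continuous_primitive hf' x₀).intervalIntegrable _ _)
    ((continuous_primitive hg' x₀).intervalIntegrable _ _)]
  ring

lemma invDeriv_smul (c : ℝ) (f : ℝ → ℝ) (x₀ : ℝ) :
    invDeriv x₀ (c • f) = c • invDeriv x₀ f := by
  ext x
  simp [invDeriv_apply, meanFree_smul, intervalIntegral.integral_const_mul, mul_sub]

lemma invDeriv_sub (hf : Continuous f) (hg : Continuous g) (x₀ : ℝ) :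
    invDeriv x₀ (f - g) = invDeriv x₀ f - invDeriv x₀ g := by
  have h := invDeriv_add (hf.sub hg) hg x₀
  rw [sub_add_cancel] at h
  rw [h, add_sub_cancel_right]

lemma abs_meanFree_le {C : ℝ} (hC : ∀ x ∈ Icc (0 : ℝ) 1, |f x| ≤ C) {x : ℝ} (hx : |f x| ≤ C) :
    |meanFree f x| ≤ 2 * C := by
  have h : ‖∫ y in (0 : ℝ)..1, f y‖ ≤ C * |1 - 0| := by
    refine intervalIntegral.norm_integral_le_of_norm_le_const fun y hy => hC y ?_
    rw [uIoc_of_le zero_le_one] at hy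
    exact Ioc_subset_Icc_self hy
  simp only [sub_zero, abs_one, mul_one, Real.norm_eq_abs] at h
  calc |meanFree f x| ≤ |f x| + |∫ y in (0 : ℝ)..1, f y| := abs_sub _ _
    _ ≤ 2 * C := by linarith

/-- Averaging over the lower limit of integration eliminates `x₀`. For `x` in `[0, 1]` only
intervals of length at most 1 remain, so the supremum bound below does not depend on `x₀`. -/
lemma invDeriv_eq_integral (hf : Continuous f) (x₀ x : ℝ) :
    invDeriv x₀ f x = ∫ z in (0 : ℝ)..1, ∫ y in z..x, meanFree f y := by
  have hc := continuous_meanFree hf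
  have h : ∀ z, ∫ y in z..x, meanFree f y =
      (∫ y in x₀..x, meanFree f y) - ∫ y in x₀..z, meanFree f y := fun z => by
    rw [eq_sub_iff_add_eq', intervalIntegral.integral_add_adjacent_intervals
      (hc.intervalIntegrable _ _) (hc.intervalIntegrable _ _)]
  rw [funext h, intervalIntegral.integral_sub intervalIntegrable_const
    ((continuous_primitive hc x₀).intervalIntegrable _ _)]
  simp [invDeriv_apply]

lemma abs_invDeriv_le_of_mem {C : ℝ} (hf : Continuous f) (hC : ∀ x ∈ Icc (0 : ℝ) 1, |f x| ≤ C)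
    (x₀ : ℝ) {x : ℝ} (hx : x ∈ Icc (0 : ℝ) 1) : |invDeriv x₀ f x| ≤ 2 * C := by
  have hC0 : 0 ≤ C := (abs_nonneg _).trans (hC 0 (by simp))
  have hz : ∀ z ∈ uIoc (0 : ℝ) 1, ‖∫ y in z..x, meanFree f y‖ ≤ 2 * C := fun z hz => by
    rw [uIoc_of_le zero_le_one] at hz
    have hz' : z ∈ Icc (0 : ℝ) 1 := Ioc_subset_Icc_self hz
    have h : ‖∫ y in z..x, meanFree f y‖ ≤ 2 * C * |x - z| := by
      refine intervalIntegral.norm_integral_le_of_norm_le_const fun y hy => ?_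
      exact abs_meanFree_le hC (hC y (uIcc_subset_Icc hz' hx (uIoc_subset_uIcc hy)))
    refine h.trans (mul_le_of_le_one_right (by positivity) ?_)
    rw [abs_le]
    constructor <;> linarith [hx.1, hx.2, hz'.1, hz'.2]
  have h := intervalIntegral.norm_integral_le_of_norm_le_const hz
  rw [invDeriv_eq_integral hf]
  simpa using h

lemma abs_invDeriv_le {C : ℝ} (hf : Continuous f) (hp : Function.Periodic f 1)
    (hC : ∀ x ∈ Icc (0 : ℝ) 1, |f x| ≤ C) (x₀ x : ℝ) : |invDeriv x₀ f x| ≤ 2 * C := by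
  obtain ⟨y, hy, hxy⟩ := (periodic_invDeriv hf hp x₀).exists_mem_Ico₀ zero_lt_one x
  rw [hxy]
  exact abs_invDeriv_le_of_mem hf hC x₀ (Ico_subset_Icc_self hy)

end InvDeriv

/-! ### Smooth functions on the circle -/

/-- The algebra of smooth functions on `ℝ / ℤ`. -/
noncomputable def smoothCircle : Subalgebra ℝ (ℝ → ℝ) where
  carrier := {f | ContDiff ℝ ∞ f ∧ Function.Periodic f 1}
  mul_mem' hf hg := ⟨hf.1.mul hg.1, hf.2.mul hg.2⟩
  add_mem' hf hg := ⟨hf.1.add hg.1, hf.2.add hg.2⟩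
  algebraMap_mem' _ := ⟨contDiff_const, fun _ => rfl⟩

lemma contDiff_coe (f : smoothCircle) : ContDiff ℝ ∞ (f : ℝ → ℝ) := f.2.1

lemma contDiff_nat_coe (f : smoothCircle) (n : ℕ) : ContDiff ℝ n (f : ℝ → ℝ) :=
  (contDiff_coe f).of_le (by exact_mod_cast le_top)

lemma periodic_coe (f : smoothCircle) : Function.Periodic (f : ℝ → ℝ) 1 := f.2.2

lemma continuous_coe (f : smoothCircle) : Continuous (f : ℝ → ℝ) := (contDiff_coe f).continuous

lemma differentiable_coe (f : smoothCircle) : Differentiable ℝ (f : ℝ → ℝ) :=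
  (contDiff_coe f).differentiable (by simp)

lemma periodic_deriv {f : ℝ → ℝ} {c : ℝ} (hp : Function.Periodic f c) :
    Function.Periodic (deriv f) c := fun x => by
  rw [← deriv_comp_add_const, hp.funext]

/-- Differentiation on `smoothCircle`. -/
noncomputable def derivₗ : smoothCircle →ₗ[ℝ] smoothCircle where
  toFun f := ⟨deriv (f : ℝ → ℝ), (contDiff_infty_iff_deriv.1 (contDiff_coe f)).2,
    periodic_deriv (periodic_coe f)⟩
  map_add' f g := Subtype.ext <| funext fun x =>
    deriv_add (differentiable_coe f x) (differentiable_coe g x)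
  map_smul' c f := Subtype.ext <| funext fun x => deriv_const_smul c (differentiable_coe f x)

/-- The projection of `smoothCircle` to the functions of mean zero. -/
noncomputable def meanFreeₗ : smoothCircle →ₗ[ℝ] smoothCircle where
  toFun f := ⟨meanFree f, (contDiff_coe f).sub contDiff_const, periodic_meanFree (periodic_coe f)⟩
  map_add' f g := Subtype.ext <| meanFree_add (continuous_coe f) (continuous_coe g)
  map_smul' c f := Subtype.ext <| meanFree_smul c f

/-- The operator `∂ₓ⁻¹` on `smoothCircle`. -/
noncomputable def invDerivₗ (x₀ : ℝ) : smoothCircle →ₗ[ℝ] smoothCircle where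
  toFun f := ⟨invDeriv x₀ f, contDiff_infty_iff_deriv.2
    ⟨fun x => (hasDerivAt_invDeriv (continuous_coe f) x₀ x).differentiableAt, by
      rw [deriv_invDeriv (continuous_coe f)]; exact (contDiff_coe (meanFreeₗ f))⟩,
    periodic_invDeriv (continuous_coe f) (periodic_coe f) x₀⟩
  map_add' f g := Subtype.ext <| invDeriv_add (continuous_coe f) (continuous_coe g) x₀
  map_smul' c f := Subtype.ext <| invDeriv_smul c f x₀

@[simp] lemma coe_derivₗ (f : smoothCircle) : (derivₗ f : ℝ → ℝ) = deriv (f : ℝ → ℝ) := rfl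

@[simp] lemma coe_meanFreeₗ (f : smoothCircle) : (meanFreeₗ f : ℝ → ℝ) = meanFree f := rfl

@[simp] lemma coe_invDerivₗ (x₀ : ℝ) (f : smoothCircle) :
    (invDerivₗ x₀ f : ℝ → ℝ) = invDeriv x₀ f := rfl

lemma derivₗ_invDerivₗ (x₀ : ℝ) (f : smoothCircle) : derivₗ (invDerivₗ x₀ f) = meanFreeₗ f :=
  Subtype.ext (deriv_invDeriv (continuous_coe f) x₀)

/-! ### Taylor seminorms -/

/-- The supremum of the `n`-th Taylor coefficients of `f`. -/
noncomputable def taylorSup (n : ℕ) (f : smoothCircle) : ℝ≥0∞ :=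
  ⨆ x : ℝ, ‖iteratedDeriv n (f : ℝ → ℝ) x‖ₑ / n !

lemma le_taylorSup (n : ℕ) (f : smoothCircle) (x : ℝ) :
    ‖iteratedDeriv n (f : ℝ → ℝ) x‖ₑ / n ! ≤ taylorSup n f :=
  le_iSup (fun x : ℝ => ‖iteratedDeriv n (f : ℝ → ℝ) x‖ₑ / n !) x

lemma enorm_apply_le_taylorSup (f : smoothCircle) (x : ℝ) :
    ‖(f : ℝ → ℝ) x‖ₑ ≤ taylorSup 0 f := by
  simpa using le_taylorSup 0 f x

lemma taylorSup_add_le (n : ℕ) (f g : smoothCircle) :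
    taylorSup n (f + g) ≤ taylorSup n f + taylorSup n g := by
  refine iSup_le fun x => ?_
  refine le_trans ?_ (add_le_add (le_taylorSup n f x) (le_taylorSup n g x))
  rw [← ENNReal.add_div]
  gcongr
  have h : iteratedDeriv n ((f + g : smoothCircle) : ℝ → ℝ) x =
      iteratedDeriv n (f : ℝ → ℝ) x + iteratedDeriv n (g : ℝ → ℝ) x :=
    iteratedDeriv_add (contDiff_nat_coe f n).contDiffAt (contDiff_nat_coe g n).contDiffAt
  rw [h]
  exact enorm_add_le _ _

@[simp] lemma taylorSup_zero (n : ℕ) : taylorSup n 0 = 0 := by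
  simp [taylorSup]

lemma taylorSup_smul (n : ℕ) (c : ℝ) (f : smoothCircle) :
    taylorSup n (c • f) = ‖c‖ₑ * taylorSup n f := by
  rw [taylorSup, taylorSup, ENNReal.mul_iSup]
  refine iSup_congr fun x => ?_
  have h : iteratedDeriv n ((c • f : smoothCircle) : ℝ → ℝ) x =
      c • iteratedDeriv n (f : ℝ → ℝ) x :=
    iteratedDeriv_const_smul (contDiff_nat_coe f n).contDiffAt c
  rw [h, enorm_smul, mul_div_assoc]

lemma taylorSup_sum_le {ι : Type*} (n : ℕ) (s : Finset ι) (f : ι → smoothCircle) :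
    taylorSup n (∑ i ∈ s, f i) ≤ ∑ i ∈ s, taylorSup n (f i) :=
  Finset.le_sum_of_subadditive _ (taylorSup_zero n).le (taylorSup_add_le n) s f

/-- The Leibniz rule divided by `n !`: the binomial coefficients cancel and leave a Cauchy product.
-/
lemma taylorSup_mul_le (n : ℕ) (f g : smoothCircle) :
    taylorSup n (f * g) ≤
      ∑ ij ∈ Finset.HasAntidiagonal.antidiagonal n, taylorSup ij.1 f * taylorSup ij.2 g := by
  refine iSup_le fun x => ?_
  have h : iteratedDeriv n ((f * g : smoothCircle) : ℝ → ℝ) x =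
      ∑ i ∈ Finset.range (n + 1), n.choose i * iteratedDeriv i (f : ℝ → ℝ) x *
        iteratedDeriv (n - i) (g : ℝ → ℝ) x :=
    iteratedDeriv_mul (contDiff_nat_coe f n).contDiffAt (contDiff_nat_coe g n).contDiffAt
  rw [h, Finset.Nat.sum_antidiagonal_eq_sum_range_succ
    (fun i j => taylorSup i f * taylorSup j g), ENNReal.div_eq_inv_mul]
  refine (mul_le_mul_right (enorm_sum_le _ _) _).trans ?_
  rw [Finset.mul_sum]
  refine Finset.sum_le_sum fun i hi => ?_
  refine le_trans (le_of_eq ?_) (mul_le_mul' (le_taylorSup i f x) (le_taylorSup (n - i) g x))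
  have hin : i ≤ n := Nat.lt_succ_iff.1 (Finset.mem_range.1 hi)
  have key : ((n ! : ℕ) : ℝ≥0∞)⁻¹ * n.choose i = (i ! : ℝ≥0∞)⁻¹ * ((n - i)! : ℝ≥0∞)⁻¹ := by
    rw [← Nat.choose_mul_factorial_mul_factorial hin]
    have h1 : ((n.choose i : ℕ) : ℝ≥0∞) ≠ 0 := by
      exact_mod_cast (Nat.choose_pos hin).ne'
    push_cast
    rw [mul_assoc, ENNReal.mul_inv (Or.inl h1) (Or.inl (by simp)), mul_comm, ← mul_assoc,
      ENNReal.mul_inv_cancel h1 (by simp), one_mul, ENNReal.mul_inv] <;>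
      simp [Nat.factorial_ne_zero]
  have hc : ‖((n.choose i : ℕ) : ℝ)‖ₑ = (n.choose i : ℝ≥0∞) := by
    simp
  rw [enorm_mul, enorm_mul, hc, ENNReal.div_eq_inv_mul, ENNReal.div_eq_inv_mul, ← mul_assoc,
    ← mul_assoc, key]
  ring

lemma taylorSup_deriv (n : ℕ) (f : smoothCircle) :
    taylorSup n (derivₗ f) = (n + 1) * taylorSup (n + 1) f := by
  rw [taylorSup, taylorSup, ENNReal.mul_iSup]
  refine iSup_congr fun x => ?_
  rw [coe_derivₗ, ← iteratedDeriv_succ', Nat.factorial_succ, ENNReal.div_eq_inv_mul,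
    ENNReal.div_eq_inv_mul, ← mul_assoc]
  push_cast
  rw [ENNReal.mul_inv (Or.inl (by simp)) (Or.inr (by simp [Nat.factorial_ne_zero])), ← mul_assoc,
    ENNReal.mul_inv_cancel (by simp) (by finiteness), one_mul]

/-- Subtracting a constant changes only the coefficient of order zero, where the mean is at most the
supremum. -/
lemma taylorSup_meanFree_le (n : ℕ) (f : smoothCircle) :
    taylorSup n (meanFreeₗ f) ≤ 2 * taylorSup n f := by
  rcases n with _ | n
  · by_cases htop : taylorSup 0 f = ⊤
    · simp [htop]
    refine iSup_le fun x => ?_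
    have hb : ∀ y, |(f : ℝ → ℝ) y| ≤ (taylorSup 0 f).toReal := fun y => by
      have := ENNReal.toReal_mono htop (enorm_apply_le_taylorSup f y)
      simpa using this
    have := abs_meanFree_le (fun y _ => hb y) (hb x)
    simp only [iteratedDeriv_zero, coe_meanFreeₗ, Nat.factorial_zero, Nat.cast_one, div_one]
    rw [← ofReal_norm, Real.norm_eq_abs]
    refine ENNReal.ofReal_le_of_le_toReal ?_
    simpa [ENNReal.toReal_mul] using this
  · have h : taylorSup (n + 1) (meanFreeₗ f) = taylorSup (n + 1) f := by
      have : deriv (meanFree (f : ℝ → ℝ)) = deriv (f : ℝ → ℝ) := by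
        ext x
        exact deriv_sub_const _
      simp only [taylorSup, coe_meanFreeₗ, iteratedDeriv_succ', this]
    rw [h, two_mul]
    exact le_self_add

lemma taylorSup_invDeriv_zero_le (x₀ : ℝ) (f : smoothCircle) :
    taylorSup 0 (invDerivₗ x₀ f) ≤ 2 * taylorSup 0 f := by
  by_cases htop : taylorSup 0 f = ⊤
  · simp [htop]
  refine iSup_le fun x => ?_
  have hb : ∀ y, |(f : ℝ → ℝ) y| ≤ (taylorSup 0 f).toReal := fun y => by
    have := ENNReal.toReal_mono htop (enorm_apply_le_taylorSup f y)
    simpa using this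
  have := abs_invDeriv_le (continuous_coe f) (periodic_coe f) (fun y _ => hb y) x₀ x
  simp only [iteratedDeriv_zero, coe_invDerivₗ, Nat.factorial_zero, Nat.cast_one, div_one]
  rw [← ofReal_norm, Real.norm_eq_abs]
  refine ENNReal.ofReal_le_of_le_toReal ?_
  simpa [ENNReal.toReal_mul] using this

/-- One derivative turns the primitive into the mean-free part; the factor `n + 1` gained by
integrating is discarded. -/
lemma taylorSup_invDeriv_succ_le (x₀ : ℝ) (n : ℕ) (f : smoothCircle) :
    taylorSup (n + 1) (invDerivₗ x₀ f) ≤ 2 * taylorSup n f := by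
  refine le_trans ?_ (taylorSup_meanFree_le n f)
  rw [← derivₗ_invDerivₗ x₀, taylorSup_deriv]
  exact le_mul_of_one_le_left' le_add_self

/-! ### Power series in time -/

/-- The linear map on power series that acts as `L` on each coefficient. -/
noncomputable def coeffwise (L : smoothCircle →ₗ[ℝ] smoothCircle) :
    smoothCircle⟦X⟧ →ₗ[ℝ] smoothCircle⟦X⟧ where
  toFun a := PowerSeries.mk fun k => L (PowerSeries.coeff k a)
  map_add' a b := by ext1 k; simp
  map_smul' c a := by ext1 k; simp

/-- The formal primitive in time that vanishes at time zero. -/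
noncomputable def timePrimitive : smoothCircle⟦X⟧ →ₗ[ℝ] smoothCircle⟦X⟧ where
  toFun a := PowerSeries.mk fun k =>
    Nat.casesOn k 0 fun j => ((j + 1 : ℕ) : ℝ)⁻¹ • PowerSeries.coeff j a
  map_add' a b := by ext1 k; cases k <;> simp
  map_smul' c a := by ext1 k; cases k <;> simp [smul_comm c]

@[simp] lemma coeff_coeffwise (L : smoothCircle →ₗ[ℝ] smoothCircle) (a : smoothCircle⟦X⟧) (k : ℕ) :
    PowerSeries.coeff k (coeffwise L a) = L (PowerSeries.coeff k a) := by
  simp [coeffwise]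

@[simp] lemma coeff_zero_timePrimitive (a : smoothCircle⟦X⟧) :
    PowerSeries.coeff 0 (timePrimitive a) = 0 := by
  simp [timePrimitive, -PowerSeries.coeff_zero_eq_constantCoeff]

@[simp] lemma coeff_succ_timePrimitive (a : smoothCircle⟦X⟧) (k : ℕ) :
    PowerSeries.coeff (k + 1) (timePrimitive a) =
      ((k + 1 : ℕ) : ℝ)⁻¹ • PowerSeries.coeff k a := by
  simp [timePrimitive]

/-- Differentiation in space of power series in time. -/
noncomputable abbrev spaceDeriv : smoothCircle⟦X⟧ →ₗ[ℝ] smoothCircle⟦X⟧ := coeffwise derivₗ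

lemma spaceDeriv_timePrimitive (a : smoothCircle⟦X⟧) :
    spaceDeriv (timePrimitive a) = timePrimitive (spaceDeriv a) := by
  ext1 k
  cases k <;> simp [-PowerSeries.coeff_zero_eq_constantCoeff]

lemma spaceDeriv_C (f : smoothCircle) :
    spaceDeriv (PowerSeries.C f) = PowerSeries.C (derivₗ f) := by
  ext1 k
  rw [coeff_coeffwise, PowerSeries.coeff_C, PowerSeries.coeff_C, apply_ite derivₗ, map_zero]

lemma spaceDeriv_invDeriv (x₀ : ℝ) (a : smoothCircle⟦X⟧) :
    spaceDeriv (coeffwise (invDerivₗ x₀) a) = coeffwise meanFreeₗ a := by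
  ext1 k
  simp only [coeff_coeffwise, derivₗ_invDerivₗ]

/-! ### The weighted norm -/

/-- The weight `R ^ n ρ ^ k / binom (n + k, n)`. -/
noncomputable def weight (R ρ : ℝ≥0) (n k : ℕ) : ℝ≥0∞ :=
  ((R ^ n * ρ ^ k / (n + k).choose n : ℝ≥0) : ℝ≥0∞)

/-- The left side is a single term of Vandermonde's sum for the right side. This makes `weight`
submultiplicative. -/
lemma choose_mul_choose_le (n m i j : ℕ) :
    (n + i).choose n * (m + j).choose m ≤ (n + m + (i + j)).choose (n + m) := by
  rw [show n + m + (i + j) = (n + i) + (m + j) by ring, Nat.add_choose_eq (n + i)]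
  exact Finset.single_le_sum
    (f := fun ij : ℕ × ℕ => (n + i).choose ij.1 * (m + j).choose ij.2)
    (fun _ _ => Nat.zero_le _) (a := (n, m)) (Finset.HasAntidiagonal.mem_antidiagonal.2 rfl)

lemma choose_pos' (n k : ℕ) : (0 : ℝ≥0) < (n + k).choose n := by
  exact_mod_cast Nat.choose_pos le_self_add

lemma weight_add_le (R ρ : ℝ≥0) (n m i j : ℕ) :
    weight R ρ (n + m) (i + j) ≤ weight R ρ n i * weight R ρ m j := by
  rw [weight, weight, weight, ← ENNReal.coe_mul, ENNReal.coe_le_coe, div_mul_div_comm]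
  have h : ((n + i).choose n * (m + j).choose m : ℝ≥0) ≤ (n + m + (i + j)).choose (n + m) := by
    exact_mod_cast choose_mul_choose_le n m i j
  rw [show R ^ (n + m) * ρ ^ (i + j) = R ^ n * ρ ^ i * (R ^ m * ρ ^ j) by ring]
  have := mul_pos (choose_pos' n i) (choose_pos' m j)
  gcongr

lemma weight_zero_right (R ρ : ℝ≥0) (n : ℕ) : weight R ρ n 0 = (R : ℝ≥0∞) ^ n := by
  simp [weight]

lemma weight_succ_right_le (R ρ : ℝ≥0) (n k : ℕ) :
    weight R ρ n (k + 1) ≤ ρ * weight R ρ n k := by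
  rw [weight, weight, ← ENNReal.coe_mul, ENNReal.coe_le_coe,
    show R ^ n * ρ ^ (k + 1) = ρ * (R ^ n * ρ ^ k) by ring, mul_div_assoc]
  have h : ((n + k).choose n : ℝ≥0) ≤ (n + (k + 1)).choose n := by
    exact_mod_cast Nat.choose_le_choose n (by omega)
  have := choose_pos' n k
  gcongr

lemma weight_succ_left_le (R ρ : ℝ≥0) (n k : ℕ) :
    weight R ρ (n + 1) k ≤ R * weight R ρ n k := by
  rw [weight, weight, ← ENNReal.coe_mul, ENNReal.coe_le_coe,
    show R ^ (n + 1) * ρ ^ k = R * (R ^ n * ρ ^ k) by ring, mul_div_assoc]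
  have h : ((n + k).choose n : ℝ≥0) ≤ (n + 1 + k).choose (n + 1) := by
    rw [Nat.choose_symm_add, Nat.choose_symm_add]
    exact_mod_cast Nat.choose_le_choose k (by omega)
  have := choose_pos' n k
  gcongr

/-- The reason for the binomial in the weight: the factor `n + 1` produced by `∂ₓ` is exchanged for
the factor `k + 1` that `∂ₜ⁻¹` divides by, at the cost of the constant `ρ / R`. -/
lemma weight_deriv {R : ℝ≥0} (hR : R ≠ 0) (ρ : ℝ≥0) (n k : ℕ) :
    ((n + 1 : ℕ) : ℝ≥0∞) * weight R ρ n (k + 1) =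
      ((k + 1 : ℕ) : ℝ≥0∞) * ((ρ / R : ℝ≥0) * weight R ρ (n + 1) k) := by
  rw [weight, weight, ← ENNReal.coe_mul, ← ENNReal.coe_natCast, ← ENNReal.coe_natCast,
    ← ENNReal.coe_mul, ← ENNReal.coe_mul, ENNReal.coe_inj]
  have h1 := choose_pos' n (k + 1)
  have h2 := choose_pos' (n + 1) k
  have h : ((n + 1 + k).choose (n + 1) : ℝ≥0) * ((n + 1 : ℕ) : ℝ≥0) =
      (n + (k + 1)).choose n * ((k + 1 : ℕ) : ℝ≥0) := by
    have := Nat.choose_succ_right_eq (n + (k + 1)) n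
    rw [show n + (k + 1) - n = k + 1 by omega] at this
    rw [show n + 1 + k = n + (k + 1) by ring]
    exact_mod_cast this
  rw [← mul_div_assoc, ← mul_div_assoc, ← mul_div_assoc, div_eq_div_iff h1.ne' h2.ne']
  calc ((n + 1 : ℕ) : ℝ≥0) * (R ^ n * ρ ^ (k + 1)) * (n + 1 + k).choose (n + 1)
      = (n + 1 + k).choose (n + 1) * ((n + 1 : ℕ) : ℝ≥0) * (R ^ n * ρ ^ (k + 1)) := by ring
    _ = (n + (k + 1)).choose n * ((k + 1 : ℕ) : ℝ≥0) * (R ^ n * ρ ^ (k + 1)) := by rw [h]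
    _ = _ := by
      field_simp
      ring

/-- Since the binomial is at most `2 ^ (n + k)`, halving both radii turns a finite norm into
ordinary absolute convergence of the double series. -/
lemma le_weight (R ρ : ℝ≥0) (n k : ℕ) :
    (((R / 2) ^ n * (ρ / 2) ^ k : ℝ≥0) : ℝ≥0∞) ≤ weight R ρ n k := by
  rw [weight, ENNReal.coe_le_coe, div_pow, div_pow, div_mul_div_comm, ← pow_add]
  have h : ((n + k).choose n : ℝ≥0) ≤ 2 ^ (n + k) := by
    exact_mod_cast Nat.choose_le_two_pow _ _
  have := choose_pos' n k
  gcongr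

/-- The weighted sum of the Taylor coefficients of a power series in time. -/
noncomputable def seriesNorm (R ρ : ℝ≥0) (a : smoothCircle⟦X⟧) : ℝ≥0∞ :=
  ∑' k, ∑' n, taylorSup n (PowerSeries.coeff k a) * weight R ρ n k

section SeriesNorm

variable (R ρ : ℝ≥0) (a b : smoothCircle⟦X⟧)

lemma seriesNorm_zero : seriesNorm R ρ 0 = 0 := by
  simp [seriesNorm]

lemma seriesNorm_add_le : seriesNorm R ρ (a + b) ≤ seriesNorm R ρ a + seriesNorm R ρ b := by
  simp only [seriesNorm]
  rw [← ENNReal.tsum_add]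
  refine ENNReal.tsum_le_tsum fun k => ?_
  rw [← ENNReal.tsum_add]
  refine ENNReal.tsum_le_tsum fun n => ?_
  rw [← add_mul, map_add]
  gcongr
  exact taylorSup_add_le _ _ _

lemma seriesNorm_smul (c : ℝ) : seriesNorm R ρ (c • a) = ‖c‖ₑ * seriesNorm R ρ a := by
  simp only [seriesNorm, ← ENNReal.tsum_mul_left]
  refine tsum_congr fun k => tsum_congr fun n => ?_
  rw [PowerSeries.coeff_smul, taylorSup_smul, mul_assoc]

lemma seriesNorm_neg : seriesNorm R ρ (-a) = seriesNorm R ρ a := by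
  rw [← neg_one_smul ℝ a, seriesNorm_smul]
  simp

lemma seriesNorm_C (f : smoothCircle) :
    seriesNorm R ρ (PowerSeries.C f) = ∑' n, taylorSup n f * (R : ℝ≥0∞) ^ n := by
  rw [seriesNorm, tsum_eq_single 0]
  · simp [weight_zero_right]
  · intro k hk
    simp [PowerSeries.coeff_C, hk]

lemma seriesNorm_one_le : seriesNorm R ρ 1 ≤ 1 := by
  rw [← map_one (PowerSeries.C (R := smoothCircle)), seriesNorm_C, tsum_eq_single 0]
  · rw [pow_zero, mul_one]
    refine iSup_le fun x => ?_
    simp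
  · intro n hn
    have h : iteratedDeriv n ((1 : smoothCircle) : ℝ → ℝ) = 0 := by
      ext x
      exact (iteratedDeriv_const (n := n) (c := (1 : ℝ)) (x := x)).trans (by simp [hn])
    simp only [taylorSup, h]
    simp

lemma tsum_sum_antidiagonal (F : ℕ → ℕ → ℝ≥0∞) :
    ∑' n, ∑ ij ∈ Finset.HasAntidiagonal.antidiagonal n, F ij.1 ij.2 = ∑' i, ∑' j, F i j := by
  rw [← ENNReal.tsum_prod, ← Finset.HasAntidiagonal.sigmaAntidiagonalEquivProd.tsum_eq
    (fun ij : ℕ × ℕ => F ij.1 ij.2), ENNReal.tsum_sigma']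
  refine tsum_congr fun n => ?_
  rw [tsum_fintype, ← Finset.sum_coe_sort]
  rfl

/-- Cauchy products in the time order and in the Taylor order, combined with submultiplicativity of
the weight. All sums are in `ℝ≥0∞`, so regrouping needs no summability. -/
lemma seriesNorm_mul_le : seriesNorm R ρ (a * b) ≤ seriesNorm R ρ a * seriesNorm R ρ b := by
  set A : ℕ → ℕ → ℝ≥0∞ := fun k n => taylorSup n (PowerSeries.coeff k a) * weight R ρ n k with hA
  set B : ℕ → ℕ → ℝ≥0∞ := fun k n => taylorSup n (PowerSeries.coeff k b) * weight R ρ n k with hB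
  have h1 : ∀ k n, taylorSup n (PowerSeries.coeff k (a * b)) * weight R ρ n k ≤
      ∑ ij ∈ Finset.HasAntidiagonal.antidiagonal k, ∑ lm ∈ Finset.HasAntidiagonal.antidiagonal n,
        A ij.1 lm.1 * B ij.2 lm.2 := by
    intro k n
    rw [PowerSeries.coeff_mul]
    refine (mul_le_mul_left (taylorSup_sum_le _ _ _) _).trans ?_
    rw [Finset.sum_mul]
    refine Finset.sum_le_sum fun ij hij => ?_
    refine (mul_le_mul_left (taylorSup_mul_le _ _ _) _).trans ?_
    rw [Finset.sum_mul]
    refine Finset.sum_le_sum fun lm hlm => ?_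
    rw [Finset.HasAntidiagonal.mem_antidiagonal] at hij hlm
    rw [← hij, ← hlm, hA, hB]
    calc _ ≤ taylorSup lm.1 (PowerSeries.coeff ij.1 a) * taylorSup lm.2 (PowerSeries.coeff ij.2 b)
          * (weight R ρ lm.1 ij.1 * weight R ρ lm.2 ij.2) := by
          gcongr
          exact weight_add_le _ _ _ _ _ _
      _ = _ := by ring
  calc seriesNorm R ρ (a * b)
      ≤ ∑' k, ∑' n, ∑ ij ∈ Finset.HasAntidiagonal.antidiagonal k,
        ∑ lm ∈ Finset.HasAntidiagonal.antidiagonal n, A ij.1 lm.1 * B ij.2 lm.2 :=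
        ENNReal.tsum_le_tsum fun k => ENNReal.tsum_le_tsum fun n => h1 k n
    _ = ∑' k, ∑ ij ∈ Finset.HasAntidiagonal.antidiagonal k, ∑' l, ∑' m, A ij.1 l * B ij.2 m := by
        refine tsum_congr fun k => ?_
        rw [Summable.tsum_finsetSum fun _ _ => ENNReal.summable]
        refine Finset.sum_congr rfl fun ij _ => ?_
        exact tsum_sum_antidiagonal fun l m => A ij.1 l * B ij.2 m
    _ = ∑' i, ∑' j, ∑' l, ∑' m, A i l * B j m :=
        tsum_sum_antidiagonal fun i j => ∑' l, ∑' m, A i l * B j m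
    _ = _ := by
        simp only [ENNReal.tsum_mul_left, ENNReal.tsum_mul_right]
        rfl

lemma seriesNorm_pow_le (n : ℕ) : seriesNorm R ρ (a ^ n) ≤ seriesNorm R ρ a ^ n := by
  induction n with
  | zero => simpa using seriesNorm_one_le R ρ
  | succ n ih =>
    rw [pow_succ, pow_succ]
    exact (seriesNorm_mul_le R ρ _ _).trans (mul_le_mul_left ih _)

lemma enorm_inv_succ (k : ℕ) : ‖((k + 1 : ℕ) : ℝ)⁻¹‖ₑ = ((k + 1 : ℕ) : ℝ≥0∞)⁻¹ := by
  rw [enorm_inv (by positivity), Real.enorm_natCast]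

lemma seriesNorm_timePrimitive_le :
    seriesNorm R ρ (timePrimitive a) ≤ ρ * seriesNorm R ρ a := by
  rw [seriesNorm, tsum_eq_zero_add' ENNReal.summable, seriesNorm, ← ENNReal.tsum_mul_left]
  simp only [coeff_zero_timePrimitive, taylorSup_zero, zero_mul, tsum_zero, zero_add]
  refine ENNReal.tsum_le_tsum fun k => ?_
  rw [← ENNReal.tsum_mul_left]
  refine ENNReal.tsum_le_tsum fun n => ?_
  rw [coeff_succ_timePrimitive, taylorSup_smul, enorm_inv_succ, ← mul_assoc, mul_comm (ρ : ℝ≥0∞),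
    mul_assoc _ (ρ : ℝ≥0∞)]
  refine mul_le_mul' (mul_le_of_le_one_left' ?_) (weight_succ_right_le R ρ n k)
  rw [ENNReal.inv_le_one]
  exact_mod_cast Nat.succ_le_succ (Nat.zero_le k)

/-- The estimate without loss of derivative: by `weight_deriv` each term on the left equals `ρ / R`
times the term of `a` with Taylor order one higher and time order one lower. -/
lemma seriesNorm_timePrimitive_spaceDeriv_le (hR : R ≠ 0) :
    seriesNorm R ρ (timePrimitive (spaceDeriv a)) ≤ (ρ / R : ℝ≥0) * seriesNorm R ρ a := by
  rw [seriesNorm, tsum_eq_zero_add' ENNReal.summable, seriesNorm, ← ENNReal.tsum_mul_left]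
  simp only [coeff_zero_timePrimitive, taylorSup_zero, zero_mul, tsum_zero, zero_add]
  refine ENNReal.tsum_le_tsum fun k => ?_
  -- Only Taylor orders `n + 1` occur on the left, so the order-zero term on the right is dropped.
  refine le_trans ?_ (mul_le_mul' le_rfl (ENNReal.tsum_comp_le_tsum_of_injective
    (Nat.succ_injective) fun n => taylorSup n (PowerSeries.coeff k a) * weight R ρ n k))
  rw [← ENNReal.tsum_mul_left]
  refine ENNReal.tsum_le_tsum fun n => ?_
  rw [coeff_succ_timePrimitive, taylorSup_smul, enorm_inv_succ, coeff_coeffwise, taylorSup_deriv]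
  have h := weight_deriv hR ρ n k
  have hk : ((k + 1 : ℕ) : ℝ≥0∞)⁻¹ * ((k + 1 : ℕ) : ℝ≥0∞) = 1 :=
    ENNReal.inv_mul_cancel (by simp) (by finiteness)
  refine le_of_eq ?_
  calc _ = ((k + 1 : ℕ) : ℝ≥0∞)⁻¹ * taylorSup (n + 1) (PowerSeries.coeff k a) *
        (((n + 1 : ℕ) : ℝ≥0∞) * weight R ρ n (k + 1)) := by push_cast; ring
    _ = (((k + 1 : ℕ) : ℝ≥0∞)⁻¹ * ((k + 1 : ℕ) : ℝ≥0∞)) * ((ρ / R : ℝ≥0) *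
        (taylorSup (n + 1) (PowerSeries.coeff k a) * weight R ρ (n + 1) k)) := by rw [h]; ring
    _ = _ := by rw [hk, one_mul]

lemma seriesNorm_meanFree_le :
    seriesNorm R ρ (coeffwise meanFreeₗ a) ≤ 2 * seriesNorm R ρ a := by
  rw [seriesNorm, seriesNorm, ← ENNReal.tsum_mul_left]
  refine ENNReal.tsum_le_tsum fun k => ?_
  rw [← ENNReal.tsum_mul_left]
  refine ENNReal.tsum_le_tsum fun n => ?_
  rw [coeff_coeffwise, ← mul_assoc]
  gcongr
  exact taylorSup_meanFree_le _ _

/-- The constant 2 bounds Taylor order zero; `2 * R` bounds the positive orders, where the index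
shift costs one factor `R`. -/
lemma seriesNorm_invDeriv_le (x₀ : ℝ) :
    seriesNorm R ρ (coeffwise (invDerivₗ x₀) a) ≤ (2 + 2 * R) * seriesNorm R ρ a := by
  rw [seriesNorm, seriesNorm, ← ENNReal.tsum_mul_left]
  refine ENNReal.tsum_le_tsum fun k => ?_
  rw [tsum_eq_zero_add' ENNReal.summable, add_mul]
  refine add_le_add ?_ ?_
  · rw [coeff_coeffwise]
    refine le_trans ?_ (mul_le_mul_right (ENNReal.le_tsum 0) _)
    rw [← mul_assoc]
    gcongr
    exact taylorSup_invDeriv_zero_le _ _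
  · rw [← ENNReal.tsum_mul_left]
    refine ENNReal.tsum_le_tsum fun n => ?_
    rw [coeff_coeffwise]
    refine (mul_le_mul' (taylorSup_invDeriv_succ_le x₀ n _) (weight_succ_left_le R ρ n k)).trans ?_
    exact le_of_eq (by ring)

end SeriesNorm

/-! ### The formal solution -/

/-- The right-hand side `-u ^ p ∂ₓ u + (p / 2) ∂ₓ⁻¹ (u ^ (p - 1) (∂ₓ u) ^ 2)` of the equation. -/
noncomputable def formalField (p : ℕ) (x₀ : ℝ) (a : smoothCircle⟦X⟧) : smoothCircle⟦X⟧ :=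
  -(a ^ p * spaceDeriv a) +
    (p / 2 : ℝ) • coeffwise (invDerivₗ x₀) (a ^ (p - 1) * (spaceDeriv a * spaceDeriv a))

/-- The Picard operator of the equation. -/
noncomputable def formalPicard (p : ℕ) (x₀ : ℝ) (f : smoothCircle) (a : smoothCircle⟦X⟧) :
    smoothCircle⟦X⟧ :=
  PowerSeries.C f + timePrimitive (formalField p x₀ a)

lemma seriesNorm_quadratic_le {R ρ : ℝ≥0} {a : smoothCircle⟦X⟧} {N : ℝ≥0∞} (p : ℕ)
    (ha : seriesNorm R ρ a ≤ N) (hda : seriesNorm R ρ (spaceDeriv a) ≤ N) :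
    seriesNorm R ρ (a ^ (p - 1) * (spaceDeriv a * spaceDeriv a)) ≤ N ^ (p - 1) * (N * N) := by
  refine (seriesNorm_mul_le R ρ _ _).trans (mul_le_mul' ?_ ?_)
  · exact (seriesNorm_pow_le R ρ _ _).trans (pow_le_pow_left' ha _)
  · exact (seriesNorm_mul_le R ρ _ _).trans (mul_le_mul' hda hda)

lemma seriesNorm_transport_le {R ρ : ℝ≥0} {a : smoothCircle⟦X⟧} {N : ℝ≥0∞} (p : ℕ)
    (ha : seriesNorm R ρ a ≤ N) (hda : seriesNorm R ρ (spaceDeriv a) ≤ N) :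
    seriesNorm R ρ (a ^ p * spaceDeriv a) ≤ N ^ p * N :=
  (seriesNorm_mul_le R ρ _ _).trans <|
    mul_le_mul' ((seriesNorm_pow_le R ρ _ _).trans (pow_le_pow_left' ha _)) hda

/-- A bound for the norms of the Picard operator and of its derivative in space. -/
noncomputable def fieldBound (p : ℕ) (R : ℝ≥0) (N : ℝ≥0∞) : ℝ≥0∞ :=
  -- The 1 serves the transport term itself and `R⁻¹` its space derivative. Likewise `2 + 2 * R`
  -- covers `∂ₓ⁻¹` as well as the constant 2 of the mean-free projection.
  (1 + (R⁻¹ : ℝ≥0)) * (N ^ p * N) +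
    ‖(p / 2 : ℝ)‖ₑ * ((2 + 2 * R) * (N ^ (p - 1) * (N * N)))

lemma seriesNorm_formalPicard_le {R ρ : ℝ≥0} {a : smoothCircle⟦X⟧} {N : ℝ≥0∞} (p : ℕ) (x₀ : ℝ)
    (f : smoothCircle) (ha : seriesNorm R ρ a ≤ N) (hda : seriesNorm R ρ (spaceDeriv a) ≤ N) :
    seriesNorm R ρ (formalPicard p x₀ f a) ≤
      seriesNorm R ρ (PowerSeries.C f) + ρ * fieldBound p R N := by
  refine (seriesNorm_add_le R ρ _ _).trans (add_le_add le_rfl ?_)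
  refine (seriesNorm_timePrimitive_le R ρ _).trans ?_
  gcongr
  refine (seriesNorm_add_le R ρ _ _).trans (add_le_add ?_ ?_)
  · rw [seriesNorm_neg]
    refine (seriesNorm_transport_le p ha hda).trans (le_mul_of_one_le_left' le_self_add)
  · rw [seriesNorm_smul]
    gcongr
    refine (seriesNorm_invDeriv_le R ρ _ x₀).trans ?_
    gcongr
    exact seriesNorm_quadratic_le p ha hda

/-- No second space derivative has to be controlled: on the transport term `∂ₓ` is absorbed by
`∂ₜ⁻¹`, and on the nonlocal term it cancels `∂ₓ⁻¹` up to the mean. -/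
lemma seriesNorm_spaceDeriv_formalPicard_le {R ρ : ℝ≥0} (hR : R ≠ 0) {a : smoothCircle⟦X⟧}
    {N : ℝ≥0∞} (p : ℕ) (x₀ : ℝ) (f : smoothCircle) (ha : seriesNorm R ρ a ≤ N)
    (hda : seriesNorm R ρ (spaceDeriv a) ≤ N) :
    seriesNorm R ρ (spaceDeriv (formalPicard p x₀ f a)) ≤
      seriesNorm R ρ (PowerSeries.C (derivₗ f)) + ρ * fieldBound p R N := by
  rw [formalPicard, map_add, spaceDeriv_C, spaceDeriv_timePrimitive, formalField, map_add, map_neg,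
    map_smul, spaceDeriv_invDeriv, map_add, map_neg, map_smul]
  refine (seriesNorm_add_le R ρ _ _).trans (add_le_add le_rfl ?_)
  refine (seriesNorm_add_le R ρ _ _).trans ?_
  rw [fieldBound, mul_add]
  refine add_le_add ?_ ?_
  · rw [seriesNorm_neg]
    refine (seriesNorm_timePrimitive_spaceDeriv_le R ρ _ hR).trans ?_
    rw [div_eq_mul_inv, ENNReal.coe_mul, mul_assoc]
    gcongr
    · exact le_add_self
    · exact seriesNorm_transport_le p ha hda
  · rw [seriesNorm_smul, mul_left_comm (ρ : ℝ≥0∞)]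
    refine mul_le_mul' le_rfl ?_
    refine (seriesNorm_timePrimitive_le R ρ _).trans ?_
    gcongr
    refine (seriesNorm_meanFree_le R ρ _).trans ?_
    gcongr
    · exact le_self_add
    · exact seriesNorm_quadratic_le p ha hda

lemma fieldBound_ne_top (p : ℕ) (R : ℝ≥0) {N : ℝ≥0∞} (hN : N ≠ ⊤) : fieldBound p R N ≠ ⊤ := by
  rw [fieldBound]
  finiteness

lemma X_pow_dvd_coeffwise (L : smoothCircle →ₗ[ℝ] smoothCircle) {a b : smoothCircle⟦X⟧} {n : ℕ}
    (h : PowerSeries.X ^ n ∣ a - b) : PowerSeries.X ^ n ∣ coeffwise L a - coeffwise L b := by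
  rw [← map_sub]
  rw [PowerSeries.X_pow_dvd_iff] at h ⊢
  intro m hm
  rw [coeff_coeffwise, h m hm, map_zero]

lemma X_pow_dvd_timePrimitive {a b : smoothCircle⟦X⟧} {n : ℕ}
    (h : PowerSeries.X ^ n ∣ a - b) :
    PowerSeries.X ^ (n + 1) ∣ timePrimitive a - timePrimitive b := by
  rw [← map_sub]
  rw [PowerSeries.X_pow_dvd_iff] at h ⊢
  rintro (_ | m) hm
  · rw [coeff_zero_timePrimitive]
  · rw [coeff_succ_timePrimitive, h m (by omega), smul_zero]

lemma dvd_mul_sub_mul' {A : Type*} [CommRing A] {x a a' b b' : A} (h : x ∣ a - a')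
    (h' : x ∣ b - b') : x ∣ a * b - a' * b' := by
  rw [show a * b - a' * b' = a * (b - b') + (a - a') * b' by ring]
  exact dvd_add (h'.mul_left _) (h.mul_right _)

/-- The `X`-adic contraction. Products and coefficientwise linear maps preserve congruence modulo `X
^ n`, and the time primitive raises the exponent by one. -/
lemma X_pow_dvd_formalPicard (p : ℕ) (x₀ : ℝ) (f : smoothCircle) {a b : smoothCircle⟦X⟧} {n : ℕ}
    (h : PowerSeries.X ^ n ∣ a - b) :
    PowerSeries.X ^ (n + 1) ∣ formalPicard p x₀ f a - formalPicard p x₀ f b := by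
  rw [formalPicard, formalPicard, add_sub_add_left_eq_sub]
  refine X_pow_dvd_timePrimitive ?_
  have hd := X_pow_dvd_coeffwise derivₗ h
  have hpow : ∀ q : ℕ, PowerSeries.X ^ n ∣ a ^ q - b ^ q := fun q =>
    h.trans (sub_dvd_pow_sub_pow a b q)
  have h1 := dvd_mul_sub_mul' (hpow p) hd
  have h2 := X_pow_dvd_coeffwise (invDerivₗ x₀)
    (dvd_mul_sub_mul' (hpow (p - 1)) (dvd_mul_sub_mul' hd hd))
  rw [formalField, formalField, add_sub_add_comm, neg_sub_neg, ← smul_sub]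
  refine dvd_add ?_ ?_
  · rw [dvd_sub_comm]; exact h1
  · rw [Algebra.smul_def]
    exact h2.mul_left _

/-- The iterates of the Picard operator. -/
noncomputable def picardIterate (p : ℕ) (x₀ : ℝ) (f : smoothCircle) (j : ℕ) : smoothCircle⟦X⟧ :=
  (formalPicard p x₀ f)^[j] 0

/-- The solution of the equation in power series in time. -/
noncomputable def formalSolution (p : ℕ) (x₀ : ℝ) (f : smoothCircle) : smoothCircle⟦X⟧ :=
  -- The coefficient of index `k` is the same in all iterates from number `k + 1` on.
  PowerSeries.mk fun k => PowerSeries.coeff k (picardIterate p x₀ f (k + 1))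

section FormalSolution

variable (p : ℕ) (x₀ : ℝ) (f : smoothCircle)

lemma picardIterate_succ (j : ℕ) :
    picardIterate p x₀ f (j + 1) = formalPicard p x₀ f (picardIterate p x₀ f j) :=
  Function.iterate_succ_apply' _ _ _

lemma X_pow_dvd_picardIterate_succ (j : ℕ) :
    PowerSeries.X ^ j ∣ picardIterate p x₀ f (j + 1) - picardIterate p x₀ f j := by
  induction j with
  | zero => simp
  | succ j ih =>
    rw [picardIterate_succ, picardIterate_succ p x₀ f j]
    rw [picardIterate_succ] at ih
    exact X_pow_dvd_formalPicard p x₀ f ih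

lemma X_pow_dvd_picardIterate {i j : ℕ} (h : i ≤ j) :
    PowerSeries.X ^ i ∣ picardIterate p x₀ f j - picardIterate p x₀ f i := by
  induction j, h using Nat.le_induction with
  | base => simp
  | succ j hij ih =>
    rw [← sub_add_sub_cancel _ (picardIterate p x₀ f j)]
    exact dvd_add ((pow_dvd_pow _ hij).trans (X_pow_dvd_picardIterate_succ p x₀ f j)) ih

lemma coeff_picardIterate {k j : ℕ} (h : k < j) :
    PowerSeries.coeff k (picardIterate p x₀ f j) =
      PowerSeries.coeff k (formalSolution p x₀ f) := by
  have := PowerSeries.X_pow_dvd_iff.1 (X_pow_dvd_picardIterate p x₀ f (Nat.succ_le_of_lt h)) k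
    (Nat.lt_succ_self k)
  rw [map_sub, sub_eq_zero] at this
  simpa [formalSolution] using this

lemma formalPicard_formalSolution :
    formalPicard p x₀ f (formalSolution p x₀ f) = formalSolution p x₀ f := by
  ext1 k
  have h : PowerSeries.X ^ k ∣ formalSolution p x₀ f - picardIterate p x₀ f k := by
    rw [PowerSeries.X_pow_dvd_iff]
    intro m hm
    rw [map_sub, coeff_picardIterate p x₀ f hm, sub_self]
  have h' := PowerSeries.X_pow_dvd_iff.1 (X_pow_dvd_formalPicard p x₀ f h) k (Nat.lt_succ_self k)
  rw [map_sub, sub_eq_zero, ← picardIterate_succ] at h'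
  rw [h', coeff_picardIterate p x₀ f (Nat.lt_succ_self k)]

lemma coeff_zero_formalSolution : PowerSeries.coeff 0 (formalSolution p x₀ f) = f := by
  rw [← formalPicard_formalSolution, formalPicard, map_add, coeff_zero_timePrimitive,
    PowerSeries.coeff_zero_C, add_zero]

lemma coeff_succ_formalSolution (k : ℕ) :
    ((k + 1 : ℕ) : ℝ) • PowerSeries.coeff (k + 1) (formalSolution p x₀ f) =
      PowerSeries.coeff k (formalField p x₀ (formalSolution p x₀ f)) := by
  conv_lhs => rw [← formalPicard_formalSolution, formalPicard, map_add, coeff_succ_timePrimitive]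
  rw [PowerSeries.coeff_C, if_neg (Nat.succ_ne_zero k), zero_add, smul_smul,
    mul_inv_cancel₀ (by positivity), one_smul]

variable {p x₀ f}

lemma seriesNorm_picardIterate_le {R ρ : ℝ≥0} (hR : R ≠ 0) {N : ℝ≥0∞}
    (hf : seriesNorm R ρ (PowerSeries.C f) + ρ * fieldBound p R N ≤ N)
    (hdf : seriesNorm R ρ (PowerSeries.C (derivₗ f)) + ρ * fieldBound p R N ≤ N) (j : ℕ) :
    seriesNorm R ρ (picardIterate p x₀ f j) ≤ N ∧
      seriesNorm R ρ (spaceDeriv (picardIterate p x₀ f j)) ≤ N := by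
  induction j with
  | zero => simp [picardIterate, seriesNorm_zero]
  | succ j ih =>
    rw [picardIterate_succ]
    exact ⟨(seriesNorm_formalPicard_le p x₀ f ih.1 ih.2).trans hf,
      (seriesNorm_spaceDeriv_formalPicard_le hR p x₀ f ih.1 ih.2).trans hdf⟩

/-- Lower semicontinuity of the norm: a partial sum over `k < j` sees only coefficients on which `b
j` already agrees with `a`. Thus convergence of the iterates in norm is not needed. -/
lemma seriesNorm_coeffwise_le_of_agree {R ρ : ℝ≥0} {N : ℝ≥0∞} {a : smoothCircle⟦X⟧}
    {b : ℕ → smoothCircle⟦X⟧} (h : ∀ k j, k < j → PowerSeries.coeff k (b j) = PowerSeries.coeff k a)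
    (hb : ∀ j, seriesNorm R ρ (b j) ≤ N) : seriesNorm R ρ a ≤ N := by
  refine ENNReal.tsum_le_of_sum_range_le fun j => ?_
  refine le_trans ?_ (hb j)
  refine le_trans (le_of_eq ?_) (ENNReal.sum_le_tsum (Finset.range j))
  exact Finset.sum_congr rfl fun k hk => by rw [h k j (Finset.mem_range.1 hk)]

lemma seriesNorm_formalSolution_le {R ρ : ℝ≥0} (hR : R ≠ 0) {N : ℝ≥0∞}
    (hf : seriesNorm R ρ (PowerSeries.C f) + ρ * fieldBound p R N ≤ N)
    (hdf : seriesNorm R ρ (PowerSeries.C (derivₗ f)) + ρ * fieldBound p R N ≤ N) :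
    seriesNorm R ρ (formalSolution p x₀ f) ≤ N ∧
      seriesNorm R ρ (spaceDeriv (formalSolution p x₀ f)) ≤ N := by
  have h := seriesNorm_picardIterate_le (x₀ := x₀) hR hf hdf
  refine ⟨seriesNorm_coeffwise_le_of_agree (fun k j hkj => coeff_picardIterate p x₀ f hkj)
    fun j => (h j).1, seriesNorm_coeffwise_le_of_agree (fun k j hkj => ?_) fun j => (h j).2⟩
  rw [coeff_coeffwise, coeff_coeffwise, coeff_picardIterate p x₀ f hkj]

/-- The formal solution has finite norm if the radius of convergence in time is small. -/
lemma exists_seriesNorm_formalSolution_ne_top {R : ℝ≥0} (hR : R ≠ 0)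
    (hf : ∑' n, taylorSup n f * (R : ℝ≥0∞) ^ n ≠ ⊤)
    (hdf : ∑' n, taylorSup n (derivₗ f) * (R : ℝ≥0∞) ^ n ≠ ⊤) :
    ∃ ρ : ℝ≥0, 0 < ρ ∧ seriesNorm R ρ (formalSolution p x₀ f) ≠ ⊤ ∧
      seriesNorm R ρ (spaceDeriv (formalSolution p x₀ f)) ≠ ⊤ := by
  -- `M` dominates the norms of both `f` and its derivative. The ball has radius `M + 1`, and `ρ = 1
  -- / (K + 1)`, with `K` the field bound on that ball, keeps the increment at most 1.
  set M := ∑' n, taylorSup n f * (R : ℝ≥0∞) ^ n + ∑' n, taylorSup n (derivₗ f) * (R : ℝ≥0∞) ^ n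
    with hM
  have hN : M + 1 ≠ ⊤ := by finiteness
  lift fieldBound p R (M + 1) to ℝ≥0 using fieldBound_ne_top p R hN with K hK
  have hρ : ((K + 1)⁻¹ : ℝ≥0) * fieldBound p R (M + 1) ≤ 1 := by
    rw [← hK, ← ENNReal.coe_mul, ← ENNReal.coe_one, ENNReal.coe_le_coe, inv_mul_le_one₀ (by positivity)]
    exact le_self_add
  have h := seriesNorm_formalSolution_le (p := p) (x₀ := x₀) (f := f) (ρ := (K + 1)⁻¹) hR
    (N := M + 1)
    (by rw [seriesNorm_C]; exact add_le_add le_self_add hρ)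
    (by rw [seriesNorm_C]; exact add_le_add le_add_self hρ)
  exact ⟨(K + 1)⁻¹, by positivity, ne_top_of_le_ne_top hN h.1, ne_top_of_le_ne_top hN h.2⟩

end FormalSolution

/-! ### Analyticity of double power series -/

section DoublePowerSeries

/-- The multilinear map whose diagonal is the monomial `(h, t) ↦ h ^ i t ^ (m - i)`. -/
noncomputable def monomialMultilinear (m i : ℕ) :
    ContinuousMultilinearMap ℝ (fun _ : Fin m => ℝ × ℝ) ℝ :=
  (ContinuousMultilinearMap.mkPiAlgebra ℝ (Fin m) ℝ).compContinuousLinearMap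
    fun l : Fin m => if (l : ℕ) < i then ContinuousLinearMap.fst ℝ ℝ ℝ
      else ContinuousLinearMap.snd ℝ ℝ ℝ

lemma norm_monomialMultilinear_le (m i : ℕ) : ‖monomialMultilinear m i‖ ≤ 1 := by
  refine (ContinuousMultilinearMap.norm_compContinuousLinearMap_le _ _).trans ?_
  rw [ContinuousMultilinearMap.norm_mkPiAlgebra, one_mul]
  refine Finset.prod_le_one (fun _ _ => norm_nonneg _) fun l _ => ?_
  split_ifs
  · exact ContinuousLinearMap.norm_fst_le ..
  · exact ContinuousLinearMap.norm_snd_le ..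

lemma monomialMultilinear_apply_diag (i j : ℕ) (y : ℝ × ℝ) :
    (monomialMultilinear (i + j) i fun _ => y) = y.1 ^ i * y.2 ^ j := by
  have h : ∀ l : Fin (i + j), (if (l : ℕ) < i then ContinuousLinearMap.fst ℝ ℝ ℝ
      else ContinuousLinearMap.snd ℝ ℝ ℝ) y = if (l : ℕ) < i then y.1 else y.2 := fun l => by
    split_ifs <;> rfl
  simp only [monomialMultilinear, ContinuousMultilinearMap.compContinuousLinearMap_apply,
    ContinuousMultilinearMap.mkPiAlgebra_apply, h]
  rw [Fin.prod_univ_add]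
  simp

/-- The formal multilinear series of the double power series with coefficients `c`. -/
noncomputable def doublePowerSeries (c : ℕ × ℕ → ℝ) : FormalMultilinearSeries ℝ (ℝ × ℝ) ℝ :=
  fun m => ∑ ij ∈ Finset.HasAntidiagonal.antidiagonal m, c ij • monomialMultilinear m ij.1

lemma hasSum_antidiagonal {F : ℕ × ℕ → ℝ} {s : ℝ} (h : HasSum F s) :
    HasSum (fun m => ∑ ij ∈ Finset.HasAntidiagonal.antidiagonal m, F ij) s := by
  have h' := (Finset.HasAntidiagonal.sigmaAntidiagonalEquivProd (A := ℕ)).hasSum_iff.2 h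
  refine h'.sigma fun m => ?_
  have := hasSum_fintype fun ij : Finset.HasAntidiagonal.antidiagonal m => F ij
  rwa [Finset.sum_coe_sort (Finset.HasAntidiagonal.antidiagonal m) F] at this

/-- The terms are grouped by total degree. The norm on `ℝ × ℝ` is the maximum, so its balls are
squares, on which the double series converges absolutely. -/
lemma hasFPowerSeriesOnBall_doublePowerSeries {c : ℕ × ℕ → ℝ} {r : ℝ≥0} (hr : 0 < r)
    (hc : Summable fun ij : ℕ × ℕ => |c ij| * (r : ℝ) ^ (ij.1 + ij.2)) {g : ℝ × ℝ → ℝ} {q : ℝ × ℝ}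
    (hg : ∀ y : ℝ × ℝ, ‖y‖ < r → g (q + y) = ∑' ij : ℕ × ℕ, c ij * (y.1 ^ ij.1 * y.2 ^ ij.2)) :
    HasFPowerSeriesOnBall g (doublePowerSeries c) q r where
  r_le := by
    refine FormalMultilinearSeries.le_radius_of_summable_norm _ ?_
    refine Summable.of_nonneg_of_le (fun _ => by positivity) (fun m => ?_)
      (hasSum_antidiagonal hc.hasSum).summable
    calc ‖doublePowerSeries c m‖ * (r : ℝ) ^ m
        ≤ (∑ ij ∈ Finset.HasAntidiagonal.antidiagonal m, |c ij|) * (r : ℝ) ^ m := by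
          gcongr
          refine (norm_sum_le _ _).trans (Finset.sum_le_sum fun ij _ => ?_)
          rw [norm_smul, Real.norm_eq_abs]
          exact mul_le_of_le_one_right (abs_nonneg _) (norm_monomialMultilinear_le _ _)
      _ = _ := by
          rw [Finset.sum_mul]
          refine Finset.sum_congr rfl fun ij hij => ?_
          rw [Finset.HasAntidiagonal.mem_antidiagonal.1 hij]
  r_pos := by exact_mod_cast hr
  hasSum := by
    intro y hy
    have hy' : ‖y‖ < r := by
      rw [mem_eball_zero_iff, enorm_eq_nnnorm, ENNReal.coe_lt_coe] at hy
      exact_mod_cast hy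
    have hsum : Summable fun ij : ℕ × ℕ => c ij * (y.1 ^ ij.1 * y.2 ^ ij.2) := by
      refine Summable.of_norm_bounded hc fun ij => ?_
      rw [norm_mul, norm_mul, norm_pow, norm_pow, pow_add, Real.norm_eq_abs]
      have h1 : ‖y.1‖ ≤ r := (norm_fst_le y).trans hy'.le
      have h2 : ‖y.2‖ ≤ r := (norm_snd_le y).trans hy'.le
      gcongr
    rw [hg y hy']
    have key : ∀ m, (doublePowerSeries c m fun _ => y) =
        ∑ ij ∈ Finset.HasAntidiagonal.antidiagonal m, c ij * (y.1 ^ ij.1 * y.2 ^ ij.2) := by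
      intro m
      rw [doublePowerSeries, _root_.sum_apply]
      refine Finset.sum_congr rfl fun ij hij => ?_
      obtain rfl := Finset.HasAntidiagonal.mem_antidiagonal.1 hij
      rw [_root_.smul_apply, monomialMultilinear_apply_diag, smul_eq_mul]
    rw [funext key]
    exact hasSum_antidiagonal hsum.hasSum

end DoublePowerSeries

/-! ### Taylor series of functions on the circle -/

lemma abs_taylorCoeff_le {n : ℕ} {f : smoothCircle} (h : taylorSup n f ≠ ⊤) (x : ℝ) :
    |iteratedDeriv n (f : ℝ → ℝ) x / n !| ≤ (taylorSup n f).toReal := by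
  have := ENNReal.toReal_mono h (le_taylorSup n f x)
  rw [abs_div, Nat.abs_cast]
  simpa using this

/-- The Lagrange remainder of degree `n` is a Taylor term of order `n + 1` at an unknown point. As
`taylorSup` is uniform in the base point, it is bounded by a term of a convergent series and tends
to zero. -/
lemma hasSum_taylor {f : smoothCircle} {r : ℝ≥0} (hr : r ≠ 0)
    (hf : ∑' n, taylorSup n f * (r : ℝ≥0∞) ^ n ≠ ⊤) (x : ℝ) {h : ℝ} (hh : |h| ≤ r) :
    HasSum (fun n => iteratedDeriv n (f : ℝ → ℝ) x / n ! * h ^ n) ((f : ℝ → ℝ) (x + h)) := by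
  have hfin : ∀ n, taylorSup n f ≠ ⊤ := fun n hn => by
    have := ENNReal.ne_top_of_tsum_ne_top hf n
    rw [hn, ENNReal.top_mul (by simp [hr])] at this
    exact this rfl
  have hsum : Summable fun n => (taylorSup n f).toReal * (r : ℝ) ^ n := by
    simpa [ENNReal.toReal_mul] using ENNReal.summable_toReal hf
  have hb : ∀ n y, |iteratedDeriv n (f : ℝ → ℝ) y / n ! * h ^ n| ≤
      (taylorSup n f).toReal * (r : ℝ) ^ n := fun n y => by
    rw [abs_mul, abs_pow]
    exact mul_le_mul (abs_taylorCoeff_le (hfin n) y) (pow_le_pow_left₀ (abs_nonneg _) hh _)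
      (by positivity) ENNReal.toReal_nonneg
  have hs : Summable fun n => iteratedDeriv n (f : ℝ → ℝ) x / n ! * h ^ n :=
    Summable.of_norm_bounded hsum fun n => hb n x
  rcases eq_or_ne h 0 with rfl | h0
  · convert hasSum_single (f := fun n => iteratedDeriv n (f : ℝ → ℝ) x / n ! * (0 : ℝ) ^ n) 0
      (fun n hn => by simp [hn]) using 1
    simp
  rw [hs.hasSum_iff_tendsto_nat, ← tendsto_add_atTop_iff_nat 1, tendsto_iff_norm_sub_tendsto_zero]
  refine squeeze_zero (fun _ => norm_nonneg _) (fun n => ?_)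
    ((tendsto_add_atTop_iff_nat 1).2 hsum.tendsto_atTop_zero)
  have hx : x ≠ x + h := by simpa using h0
  have hcd : ContDiff ℝ (n + 1) (f : ℝ → ℝ) := by exact_mod_cast contDiff_nat_coe f (n + 1)
  obtain ⟨x', -, hx'⟩ := taylor_mean_remainder_lagrange_iteratedDeriv hx hcd.contDiffOn (n := n)
  rw [add_sub_cancel_left] at hx'
  have ht : taylorWithinEval (f : ℝ → ℝ) n (uIcc x (x + h)) x (x + h) =
      ∑ k ∈ Finset.range (n + 1), iteratedDeriv k (f : ℝ → ℝ) x / k ! * h ^ k := by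
    rw [taylor_within_apply]
    refine Finset.sum_congr rfl fun k _ => ?_
    rw [iteratedDerivWithin_eq_iteratedDeriv (uniqueDiffOn_uIcc hx)
      (contDiff_nat_coe f k).contDiffAt left_mem_uIcc, add_sub_cancel_left, smul_eq_mul]
    ring
  rw [norm_sub_rev, ← ht, hx', mul_div_right_comm]
  exact hb (n + 1) x'

/-! ### Summation of power series in time -/

/-- The sum of a power series in time. -/
noncomputable def evalSeries (a : smoothCircle⟦X⟧) (x t : ℝ) : ℝ :=
  ∑' k, (PowerSeries.coeff k a).1 x * t ^ k

section EvalSeries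

variable {R ρ : ℝ≥0} {a b : smoothCircle⟦X⟧}

lemma seriesNorm_half_ne_top (ha : seriesNorm R ρ a ≠ ⊤) :
    ∑' k, ∑' n, taylorSup n (PowerSeries.coeff k a) *
      (((R / 2) ^ n * (ρ / 2) ^ k : ℝ≥0) : ℝ≥0∞) ≠ ⊤ := by
  refine ne_top_of_le_ne_top ha (ENNReal.tsum_le_tsum fun k => ENNReal.tsum_le_tsum fun n => ?_)
  gcongr
  exact le_weight R ρ n k

lemma tsum_taylorSup_coeff_ne_top (hρ : ρ ≠ 0) (ha : seriesNorm R ρ a ≠ ⊤) (k : ℕ) :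
    ∑' n, taylorSup n (PowerSeries.coeff k a) * ((R / 2 : ℝ≥0) : ℝ≥0∞) ^ n ≠ ⊤ := by
  have h := ENNReal.ne_top_of_tsum_ne_top (seriesNorm_half_ne_top ha) k
  simp only [ENNReal.coe_mul, ← mul_assoc, ENNReal.tsum_mul_right, ENNReal.coe_pow] at h
  intro htop
  rw [htop, ENNReal.top_mul (by simp [hρ])] at h
  exact h rfl

lemma taylorSup_coeff_ne_top (hR : R ≠ 0) (hρ : ρ ≠ 0) (ha : seriesNorm R ρ a ≠ ⊤) (n k : ℕ) :
    taylorSup n (PowerSeries.coeff k a) ≠ ⊤ := by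
  have h := ENNReal.ne_top_of_tsum_ne_top (tsum_taylorSup_coeff_ne_top hρ ha k) n
  intro htop
  rw [htop, ENNReal.top_mul (by simp [hR])] at h
  exact h rfl

lemma summable_taylorSup (ha : seriesNorm R ρ a ≠ ⊤) :
    Summable fun kn : ℕ × ℕ => (taylorSup kn.2 (PowerSeries.coeff kn.1 a)).toReal *
      (((R / 2 : ℝ≥0) : ℝ) ^ kn.2 * ((ρ / 2 : ℝ≥0) : ℝ) ^ kn.1) := by
  have h := seriesNorm_half_ne_top ha
  rw [← ENNReal.tsum_prod] at h
  simpa only [ENNReal.toReal_mul, ENNReal.coe_toReal, NNReal.coe_mul, NNReal.coe_pow] using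
    ENNReal.summable_toReal h

lemma summable_sup (ha : seriesNorm R ρ a ≠ ⊤) :
    Summable fun k => (taylorSup 0 (PowerSeries.coeff k a)).toReal * ((ρ / 2 : ℝ≥0) : ℝ) ^ k := by
  have h := (summable_taylorSup ha).comp_injective
    (i := fun k : ℕ => (k, 0)) fun _ _ h => (Prod.ext_iff.1 h).1
  simpa [Function.comp_def] using h

lemma abs_coeff_le (hR : R ≠ 0) (hρ : ρ ≠ 0) (ha : seriesNorm R ρ a ≠ ⊤) (k : ℕ) (x : ℝ) :
    |(PowerSeries.coeff k a).1 x| ≤ (taylorSup 0 (PowerSeries.coeff k a)).toReal := by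
  simpa using abs_taylorCoeff_le (taylorSup_coeff_ne_top hR hρ ha 0 k) x

lemma norm_term_le (hR : R ≠ 0) (hρ : ρ ≠ 0) (ha : seriesNorm R ρ a ≠ ⊤) (k : ℕ) (x : ℝ) {t : ℝ}
    (ht : |t| ≤ (ρ / 2 : ℝ≥0)) :
    ‖(PowerSeries.coeff k a).1 x * t ^ k‖ ≤
      (taylorSup 0 (PowerSeries.coeff k a)).toReal * ((ρ / 2 : ℝ≥0) : ℝ) ^ k := by
  rw [norm_mul, norm_pow, Real.norm_eq_abs, Real.norm_eq_abs]
  exact mul_le_mul (abs_coeff_le hR hρ ha k x) (pow_le_pow_left₀ (abs_nonneg _) ht _)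
    (by positivity) ENNReal.toReal_nonneg

lemma summable_norm_term (hR : R ≠ 0) (hρ : ρ ≠ 0) (ha : seriesNorm R ρ a ≠ ⊤) (x : ℝ) {t : ℝ}
    (ht : |t| ≤ (ρ / 2 : ℝ≥0)) :
    Summable fun k => ‖(PowerSeries.coeff k a).1 x * t ^ k‖ :=
  Summable.of_nonneg_of_le (fun _ => norm_nonneg _) (fun k => norm_term_le hR hρ ha k x ht)
    (summable_sup ha)

/-- The sum of a power series of finite norm is analytic in space and time. -/
lemma analyticOnNhd_evalSeries (hR : R ≠ 0) (hρ : ρ ≠ 0) (ha : seriesNorm R ρ a ≠ ⊤) {ε : ℝ≥0}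
    (hε : 0 < ε) (hεR : ε ≤ R / 2) (hερ : ε ≤ ρ / 2) :
    AnalyticOnNhd ℝ (fun q : ℝ × ℝ => evalSeries a q.1 q.2) (univ ×ˢ Ioo (-(ε : ℝ)) ε) := by
  rintro ⟨x, t⟩ ⟨-, ht⟩
  have hcoeff := fun n k => taylorSup_coeff_ne_top hR hρ ha n k
  set c : ℕ × ℕ → ℝ := fun nk =>
    iteratedDeriv nk.1 (PowerSeries.coeff nk.2 a).1 x / nk.1 ! with hc
  have hsum : Summable fun nk : ℕ × ℕ => |c nk| * (ε : ℝ) ^ (nk.1 + nk.2) := by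
    have h := (Equiv.prodComm ℕ ℕ).summable_iff.2 (summable_taylorSup ha)
    refine Summable.of_nonneg_of_le (fun _ => by positivity) (fun nk => ?_) h
    simp only [Function.comp_apply, Equiv.prodComm_apply, Prod.fst_swap, Prod.snd_swap]
    rw [pow_add]
    have h1 : (ε : ℝ) ≤ ((R / 2 : ℝ≥0) : ℝ) := by exact_mod_cast hεR
    have h2 : (ε : ℝ) ≤ ((ρ / 2 : ℝ≥0) : ℝ) := by exact_mod_cast hερ
    have h3 := abs_taylorCoeff_le (hcoeff nk.1 nk.2) x
    gcongr
  -- The expansion is centred at `(x, 0)`; in the maximum norm `(x, t)` is at distance `|t| < ε`, so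
  -- it lies in the ball.
  have hball : HasFPowerSeriesOnBall (fun q : ℝ × ℝ => evalSeries a q.1 q.2)
      (doublePowerSeries c) (x, 0) ε := by
    refine hasFPowerSeriesOnBall_doublePowerSeries hε hsum fun y hy => ?_
    have hy1 : |y.1| ≤ ε := (norm_fst_le y).trans hy.le
    have hy2 : |y.2| ≤ ε := (norm_snd_le y).trans hy.le
    have hterm : Summable fun nk : ℕ × ℕ => c nk * (y.1 ^ nk.1 * y.2 ^ nk.2) := by
      refine Summable.of_norm_bounded hsum fun nk => ?_
      rw [norm_mul, norm_mul, norm_pow, norm_pow, pow_add, Real.norm_eq_abs, Real.norm_eq_abs,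
        Real.norm_eq_abs]
      gcongr
    simp only [Prod.fst_add, Prod.snd_add, zero_add, evalSeries]
    have hswap := hterm
    rw [← (Equiv.prodComm ℕ ℕ).summable_iff] at hswap
    rw [← (Equiv.prodComm ℕ ℕ).tsum_eq]
    refine Eq.trans ?_ hswap.tsum_prod.symm
    refine tsum_congr fun k => ?_
    have hT := hasSum_taylor (r := R / 2) (by simp [hR]) (tsum_taylorSup_coeff_ne_top hρ ha k) x
      (hy1.trans (by exact_mod_cast hεR))
    rw [← hT.tsum_eq, ← tsum_mul_right]
    refine tsum_congr fun n => ?_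
    simp [hc, mul_assoc]
  refine hball.analyticAt_of_mem ?_
  rw [Metric.mem_eball, Prod.edist_eq]
  rw [edist_self, max_eq_right zero_le, edist_dist, Real.dist_eq, sub_zero]
  exact (ENNReal.ofReal_lt_coe_iff (by positivity)).2 (abs_lt.2 ht)

lemma evalSeries_add (hR : R ≠ 0) (hρ : ρ ≠ 0) (ha : seriesNorm R ρ a ≠ ⊤)
    (hb : seriesNorm R ρ b ≠ ⊤) (x : ℝ) {t : ℝ} (ht : |t| ≤ (ρ / 2 : ℝ≥0)) :
    evalSeries (a + b) x t = evalSeries a x t + evalSeries b x t := by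
  rw [evalSeries, evalSeries, evalSeries, ← (summable_norm_term hR hρ ha x ht).of_norm.tsum_add
    (summable_norm_term hR hρ hb x ht).of_norm]
  refine tsum_congr fun k => ?_
  rw [map_add, ← add_mul]
  rfl

lemma evalSeries_smul (c : ℝ) (a : smoothCircle⟦X⟧) (x t : ℝ) :
    evalSeries (c • a) x t = c * evalSeries a x t := by
  rw [evalSeries, evalSeries, ← tsum_mul_left]
  refine tsum_congr fun k => ?_
  rw [← mul_assoc]
  rfl

lemma evalSeries_neg (a : smoothCircle⟦X⟧) (x t : ℝ) :
    evalSeries (-a) x t = -evalSeries a x t := by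
  rw [← neg_one_smul ℝ a, evalSeries_smul, neg_one_mul]

lemma evalSeries_mul (hR : R ≠ 0) (hρ : ρ ≠ 0) (ha : seriesNorm R ρ a ≠ ⊤)
    (hb : seriesNorm R ρ b ≠ ⊤) (x : ℝ) {t : ℝ} (ht : |t| ≤ (ρ / 2 : ℝ≥0)) :
    evalSeries (a * b) x t = evalSeries a x t * evalSeries b x t := by
  rw [evalSeries, evalSeries, evalSeries,
    tsum_mul_tsum_eq_tsum_sum_antidiagonal_of_summable_norm (summable_norm_term hR hρ ha x ht)
    (summable_norm_term hR hρ hb x ht)]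
  refine tsum_congr fun k => ?_
  rw [PowerSeries.coeff_mul, AddSubmonoidClass.coe_finsetSum, Finset.sum_apply, Finset.sum_mul]
  refine Finset.sum_congr rfl fun ij hij => ?_
  rw [← Finset.HasAntidiagonal.mem_antidiagonal.1 hij, pow_add, MulMemClass.coe_mul, Pi.mul_apply]
  ring

lemma evalSeries_C (f : smoothCircle) (x t : ℝ) :
    evalSeries (PowerSeries.C f) x t = (f : ℝ → ℝ) x := by
  rw [evalSeries, tsum_eq_single 0]
  · simp
  · intro k hk
    rw [PowerSeries.coeff_C, if_neg hk]
    simp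

lemma seriesNorm_mul_ne_top (ha : seriesNorm R ρ a ≠ ⊤) (hb : seriesNorm R ρ b ≠ ⊤) :
    seriesNorm R ρ (a * b) ≠ ⊤ :=
  ne_top_of_le_ne_top (by finiteness) (seriesNorm_mul_le R ρ a b)

lemma seriesNorm_pow_ne_top (ha : seriesNorm R ρ a ≠ ⊤) (n : ℕ) :
    seriesNorm R ρ (a ^ n) ≠ ⊤ :=
  ne_top_of_le_ne_top (by finiteness) (seriesNorm_pow_le R ρ a n)

lemma evalSeries_pow (hR : R ≠ 0) (hρ : ρ ≠ 0) (ha : seriesNorm R ρ a ≠ ⊤) (n : ℕ) (x : ℝ) {t : ℝ}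
    (ht : |t| ≤ (ρ / 2 : ℝ≥0)) :
    evalSeries (a ^ n) x t = evalSeries a x t ^ n := by
  induction n with
  | zero =>
    rw [pow_zero, pow_zero, ← map_one (PowerSeries.C (R := smoothCircle)), evalSeries_C]
    rfl
  | succ n ih =>
    rw [pow_succ, pow_succ, evalSeries_mul hR hρ (seriesNorm_pow_ne_top ha n) ha x ht, ih]

lemma hasDerivAt_evalSeries_space (hR : R ≠ 0) (hρ : ρ ≠ 0) (ha : seriesNorm R ρ a ≠ ⊤)
    (hda : seriesNorm R ρ (spaceDeriv a) ≠ ⊤) (x : ℝ) {t : ℝ} (ht : |t| ≤ (ρ / 2 : ℝ≥0)) :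
    HasDerivAt (fun y => evalSeries a y t) (evalSeries (spaceDeriv a) x t) x := by
  refine hasDerivAt_tsum (summable_sup hda) (fun k y => ?_)
    (fun k y => norm_term_le hR hρ hda k y ht) (summable_norm_term hR hρ ha 0 ht).of_norm x
  rw [coeff_coeffwise]
  exact ((differentiable_coe (PowerSeries.coeff k a)) y).hasDerivAt.mul_const _

lemma evalSeries_zero_time (a : smoothCircle⟦X⟧) (x : ℝ) :
    evalSeries a x 0 = (PowerSeries.coeff 0 a).1 x := by
  rw [evalSeries, tsum_eq_single 0]
  · simp
  · intro k hk
    simp [hk]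

/-- The hypothesis `hab` says that `b` is the formal time derivative of `a`. The constant term is
split off so that the remaining terms differentiate exactly to those of `b`, whose finite norm
supplies the uniform bound. -/
lemma hasDerivAt_evalSeries_time (hR : R ≠ 0) (hρ : ρ ≠ 0) (ha : seriesNorm R ρ a ≠ ⊤)
    (hb : seriesNorm R ρ b ≠ ⊤)
    (hab : ∀ k : ℕ, ((k + 1 : ℕ) : ℝ) • PowerSeries.coeff (k + 1) a = PowerSeries.coeff k b)
    (x : ℝ) {t : ℝ} (ht : |t| < (ρ / 2 : ℝ≥0)) :
    HasDerivAt (fun τ => evalSeries a x τ) (evalSeries b x t) t := by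
  set s : ℝ := ((ρ / 2 : ℝ≥0) : ℝ) with hs
  have hcoeff : ∀ k, ((k + 1 : ℕ) : ℝ) * (PowerSeries.coeff (k + 1) a).1 x =
      (PowerSeries.coeff k b).1 x := fun k => by
    rw [← hab k]
    rfl
  have hmem : ∀ {τ : ℝ}, τ ∈ Ioo (-s) s → |τ| ≤ s := fun hτ => (abs_lt.2 hτ).le
  have htail : HasDerivAt (fun τ => ∑' k, (PowerSeries.coeff (k + 1) a).1 x * τ ^ (k + 1))
      (evalSeries b x t) t := by
    refine hasDerivAt_tsum_of_isPreconnected (t := Ioo (-s) s) (y₀ := t) (summable_sup hb)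
      isOpen_Ioo isPreconnected_Ioo (fun k τ _ => ?_)
      (fun k τ hτ => norm_term_le hR hρ hb k x (hmem hτ)) (abs_lt.1 ht) ?_ (abs_lt.1 ht)
    · rw [← hcoeff k]
      refine ((hasDerivAt_pow (k + 1) τ).const_mul _).congr_deriv ?_
      rw [Nat.add_sub_cancel]
      ring
    · exact (summable_nat_add_iff 1).2 (summable_norm_term hR hρ ha x ht.le).of_norm
  refine (htail.const_add ((PowerSeries.coeff 0 a).1 x)).congr_of_eventuallyEq ?_
  filter_upwards [isOpen_Ioo.mem_nhds (abs_lt.1 ht)] with τ hτ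
  rw [evalSeries, (summable_norm_term hR hρ ha x (hmem hτ)).of_norm.tsum_eq_zero_add]
  simp

lemma periodic_evalSeries (a : smoothCircle⟦X⟧) (t : ℝ) :
    Function.Periodic (fun x => evalSeries a x t) 1 := fun x =>
  tsum_congr fun k => by rw [periodic_coe (PowerSeries.coeff k a) x]

lemma continuous_evalSeries (hR : R ≠ 0) (hρ : ρ ≠ 0) (ha : seriesNorm R ρ a ≠ ⊤) {t : ℝ}
    (ht : |t| ≤ (ρ / 2 : ℝ≥0)) : Continuous fun x => evalSeries a x t :=
  continuous_tsum (fun _ => (continuous_coe _).mul continuous_const) (summable_sup ha)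
    fun k x => norm_term_le hR hρ ha k x ht

/-- The partial sums converge uniformly in space, and `∂ₓ⁻¹` is bounded by 2 in the supremum norm of
periodic functions, so it passes to the limit. -/
lemma evalSeries_invDeriv (hR : R ≠ 0) (hρ : ρ ≠ 0) (ha : seriesNorm R ρ a ≠ ⊤) (x₀ x : ℝ) {t : ℝ}
    (ht : |t| ≤ (ρ / 2 : ℝ≥0)) :
    evalSeries (coeffwise (invDerivₗ x₀) a) x t = invDeriv x₀ (fun y => evalSeries a y t) x := by
  have hIa : seriesNorm R ρ (coeffwise (invDerivₗ x₀) a) ≠ ⊤ :=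
    ne_top_of_le_ne_top (by finiteness) (seriesNorm_invDeriv_le R ρ a x₀)
  have h1 := (summable_norm_term hR hρ hIa x ht).of_norm.hasSum.tendsto_sum_nat
  refine tendsto_nhds_unique h1 ?_
  have hunif := tendstoUniformly_tsum_nat (summable_sup ha)
    (fun k y => norm_term_le hR hρ ha k y ht)
  have hcont := continuous_evalSeries hR hρ ha ht
  rw [Metric.tendsto_nhds]
  intro δ hδ
  rw [Metric.tendstoUniformly_iff] at hunif
  filter_upwards [hunif (δ / 3) (by positivity)] with N hN
  set S : smoothCircle := ∑ k ∈ Finset.range N, t ^ k • PowerSeries.coeff k a with hS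
  have hSapply : ∀ y, (S : ℝ → ℝ) y =
      ∑ k ∈ Finset.range N, (PowerSeries.coeff k a).1 y * t ^ k := fun y => by
    rw [hS, AddSubmonoidClass.coe_finsetSum, Finset.sum_apply]
    exact Finset.sum_congr rfl fun k _ => mul_comm _ _
  have hIS : ∑ k ∈ Finset.range N,
      (PowerSeries.coeff k (coeffwise (invDerivₗ x₀) a)).1 x * t ^ k =
      invDeriv x₀ (S : ℝ → ℝ) x := by
    rw [← coe_invDerivₗ, hS, map_sum, AddSubmonoidClass.coe_finsetSum, Finset.sum_apply]
    refine Finset.sum_congr rfl fun k _ => ?_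
    rw [coeff_coeffwise, map_smul, mul_comm]
    rfl
  rw [hIS, dist_comm, Real.dist_eq, ← Pi.sub_apply, ← invDeriv_sub hcont (continuous_coe S)]
  refine lt_of_le_of_lt (abs_invDeriv_le (C := δ / 3) (hcont.sub (continuous_coe S))
    ((periodic_evalSeries a t).sub (periodic_coe S)) (fun y _ => ?_) x₀ x) (by linarith)
  have := hN y
  rw [Real.dist_eq, ← hSapply] at this
  exact this.le

end EvalSeries

/-! ### Cauchy estimates for analytic functions on the circle -/

lemma abs_iteratedDeriv_le_of_hasFPowerSeriesOnBall {f : ℝ → ℝ} {q : FormalMultilinearSeries ℝ ℝ ℝ}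
    {x : ℝ} {r : ℝ≥0∞} (h : HasFPowerSeriesOnBall f q x r) (n : ℕ) :
    |iteratedDeriv n f x / n !| ≤ ‖q n‖ := by
  have h1 := h.factorial_smul 1 n
  rw [← iteratedDeriv_eq_iteratedFDeriv] at h1
  rw [← h1, nsmul_eq_mul, mul_div_cancel_left₀ _ (by positivity)]
  simp

/-- The series at `z` is re-expanded at nearby `x`. With `s` half of a radius inside the disc of
convergence, the total sum of all re-expanded coefficients converges because `s + s` is below the
radius; this sum is the constant, uniform in `x` and `n`. -/
lemma exists_nhds_abs_iteratedDeriv_le {f : ℝ → ℝ} {z : ℝ} (hf : AnalyticAt ℝ f z) :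
    ∃ U ∈ 𝓝 z, ∃ s C : ℝ≥0, 0 < s ∧ ∀ x ∈ U, ∀ n : ℕ,
      |iteratedDeriv n f x / n !| * (s : ℝ) ^ n ≤ C := by
  obtain ⟨q, r, hq⟩ := hf
  obtain ⟨r', hr'0, hr'⟩ := ENNReal.lt_iff_exists_nnreal_btwn.1 hq.r_pos
  have hr'0 : 0 < r' := by exact_mod_cast hr'0
  have hss : ((r' / 2 : ℝ≥0) : ℝ≥0∞) + ((r' / 2 : ℝ≥0) : ℝ≥0∞) < q.radius := by
    rw [← ENNReal.coe_add, add_halves]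
    exact hr'.trans_le hq.r_le
  set s := r' / 2 with hs
  have hs0 : 0 < s := half_pos hr'0
  have hsr : (s : ℝ≥0∞) < r :=
    lt_of_le_of_lt (by exact_mod_cast half_le_self hr'0.le) hr'
  have hsum := NNReal.summable_sigma.1 (q.changeOriginSeries_summable_aux₁ hss)
  refine ⟨Metric.closedBall z s, Metric.closedBall_mem_nhds z (by exact_mod_cast hs0), s,
    _, hs0, fun x hx n => (?_ : _ ≤ ((∑' k : ℕ, ∑' c : Σ l : ℕ, { t : Finset (Fin (k + l)) //
      t.card = l }, ‖q (k + c.1)‖₊ * s ^ c.1 * s ^ k : ℝ≥0) : ℝ))⟩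
  have hxs : ‖x - z‖₊ ≤ s := by
    rw [Metric.mem_closedBall, dist_eq_norm] at hx
    exact_mod_cast hx
  have hxs' : (‖x - z‖₊ : ℝ≥0∞) ≤ s := by exact_mod_cast hxs
  have hx' : ‖x - z‖ₑ < r := lt_of_le_of_lt hxs' hsr
  have hxq := hq.changeOrigin hx'
  rw [add_sub_cancel] at hxq
  have h1 := abs_iteratedDeriv_le_of_hasFPowerSeriesOnBall hxq n
  have h2 : ‖q.changeOrigin (x - z) n‖₊ ≤
      ∑' c : Σ l : ℕ, { t : Finset (Fin (n + l)) // t.card = l }, ‖q (n + c.1)‖₊ * s ^ c.1 := by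
    have hlt : (s : ℝ≥0∞) < q.radius := hsr.trans_le hq.r_le
    refine (q.nnnorm_changeOrigin_le n (hxs'.trans_lt hlt)).trans ?_
    have hs2 := q.changeOriginSeries_summable_aux₂ hlt n
    have hle : ∀ c : Σ l : ℕ, { t : Finset (Fin (n + l)) // t.card = l },
        ‖q (n + c.1)‖₊ * ‖x - z‖₊ ^ c.1 ≤ ‖q (n + c.1)‖₊ * s ^ c.1 := fun c => by gcongr
    exact (NNReal.summable_of_le hle hs2).tsum_le_tsum hle hs2
  calc |iteratedDeriv n f x / n !| * (s : ℝ) ^ n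
      ≤ ‖q.changeOrigin (x - z) n‖ * (s : ℝ) ^ n := by gcongr
    _ = ((‖q.changeOrigin (x - z) n‖₊ * s ^ n : ℝ≥0) : ℝ) := by push_cast; rfl
    _ ≤ _ := by
      rw [NNReal.coe_le_coe]
      refine (mul_le_mul_left h2 _).trans ?_
      rw [← NNReal.tsum_mul_right]
      exact hsum.2.le_tsum n fun _ _ => zero_le

lemma periodic_iteratedDeriv {f : ℝ → ℝ} (hp : Function.Periodic f 1) (n : ℕ) :
    Function.Periodic (iteratedDeriv n f) 1 := by
  induction n with
  | zero => simpa using hp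
  | succ n ih =>
    rw [iteratedDeriv_succ]
    exact periodic_deriv ih

/-- The local estimates are glued over the compact period `[0, 1]`: shrinking `s` preserves a bound,
so finite unions take the smaller `s` and the larger `C`. Periodicity gives the remaining points. -/
lemma exists_abs_iteratedDeriv_le {f : ℝ → ℝ} (hf : AnalyticOnNhd ℝ f univ)
    (hp : Function.Periodic f 1) :
    ∃ s C : ℝ≥0, 0 < s ∧ ∀ (x : ℝ) (n : ℕ), |iteratedDeriv n f x / n !| * (s : ℝ) ^ n ≤ C := by
  have hcompact : ∃ s C : ℝ≥0, 0 < s ∧ ∀ x ∈ Icc (0 : ℝ) 1, ∀ n : ℕ,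
      |iteratedDeriv n f x / n !| * (s : ℝ) ^ n ≤ C := by
    refine isCompact_Icc.induction_on (p := fun S => ∃ s C : ℝ≥0, 0 < s ∧ ∀ x ∈ S, ∀ n : ℕ,
      |iteratedDeriv n f x / n !| * (s : ℝ) ^ n ≤ C) ?_ ?_ ?_ ?_
    · exact ⟨1, 0, one_pos, by simp⟩
    · rintro S T hST ⟨s, C, hs, h⟩
      exact ⟨s, C, hs, fun x hx => h x (hST hx)⟩
    · rintro S T ⟨s, C, hs, h⟩ ⟨s', C', hs', h'⟩
      refine ⟨min s s', max C C', lt_min hs hs', fun x hx n => ?_⟩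
      have key : ∀ σ : ℝ≥0, min s s' ≤ σ → |iteratedDeriv n f x / n !| * ((min s s' : ℝ≥0) : ℝ) ^ n ≤
          |iteratedDeriv n f x / n !| * (σ : ℝ) ^ n := fun σ hσ => by gcongr
      rcases hx with hx | hx
      · refine (key s (min_le_left _ _)).trans ((h x hx n).trans ?_)
        exact_mod_cast le_max_left C C'
      · refine (key s' (min_le_right _ _)).trans ((h' x hx n).trans ?_)
        exact_mod_cast le_max_right C C'
    · intro z _
      obtain ⟨U, hU, h⟩ := exists_nhds_abs_iteratedDeriv_le (hf z (mem_univ z))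
      exact ⟨U, mem_nhdsWithin_of_mem_nhds hU, h⟩
  obtain ⟨s, C, hs, h⟩ := hcompact
  refine ⟨s, C, hs, fun x n => ?_⟩
  obtain ⟨y, hy, hxy⟩ := (periodic_iteratedDeriv hp n).exists_mem_Ico₀ zero_lt_one x
  rw [hxy]
  exact h y (Ico_subset_Icc_self hy) n

/-- The Taylor coefficients of an analytic function on the circle decay exponentially, uniformly
in the base point. -/
lemma exists_tsum_taylorSup_ne_top (f : smoothCircle) (hf : AnalyticOnNhd ℝ (f : ℝ → ℝ) univ) :
    ∃ R : ℝ≥0, R ≠ 0 ∧ ∑' n, taylorSup n f * (R : ℝ≥0∞) ^ n ≠ ⊤ ∧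
      ∑' n, taylorSup n (derivₗ f) * (R : ℝ≥0∞) ^ n ≠ ⊤ := by
  obtain ⟨s, C, hs, h⟩ := exists_abs_iteratedDeriv_le hf (periodic_coe f)
  have hle : ∀ n, taylorSup n f ≤ ((C / s ^ n : ℝ≥0) : ℝ≥0∞) := fun n => iSup_le fun x => by
    have hx := h x n
    rw [abs_div, Nat.abs_cast, ← Real.norm_eq_abs, ← coe_nnnorm] at hx
    have hx' : ‖iteratedDeriv n (f : ℝ → ℝ) x‖₊ / (n ! : ℝ≥0) * s ^ n ≤ C := by exact_mod_cast hx
    rw [enorm_eq_nnnorm, ← ENNReal.coe_natCast, ← ENNReal.coe_div (by positivity),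
      ENNReal.coe_le_coe, le_div_iff₀ (by positivity)]
    exact hx'
  have hgeom : ∀ D : ℝ≥0, ∑' n : ℕ, ((D * (1 / 2) ^ n : ℝ≥0) : ℝ≥0∞) ≠ ⊤ := fun D => by
    rw [ENNReal.tsum_coe_ne_top_iff_summable]
    exact (NNReal.summable_geometric (by norm_num)).mul_left D
  -- The quarter leaves a geometric ratio `1 / 2` even after the factor `n + 1 ≤ 2 ^ n` from the
  -- derivative.
  refine ⟨s / 4, by positivity, ne_top_of_le_ne_top (hgeom C) (ENNReal.tsum_le_tsum fun n => ?_),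
    ne_top_of_le_ne_top (hgeom (C / s)) (ENNReal.tsum_le_tsum fun n => ?_)⟩
  · refine (mul_le_mul_left (hle n) _).trans ?_
    rw [← ENNReal.coe_pow, ← ENNReal.coe_mul, ENNReal.coe_le_coe,
      show C / s ^ n * (s / 4) ^ n = C * (1 / 4) ^ n by
        rw [div_pow, div_pow, one_pow]; field_simp]
    gcongr
    norm_num
  · rw [taylorSup_deriv]
    refine (mul_le_mul_left (mul_le_mul_right (hle (n + 1)) _) _).trans ?_
    have hn : ((n + 1 : ℕ) : ℝ≥0) ≤ 2 ^ n := by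
      exact_mod_cast Nat.succ_le_of_lt Nat.lt_two_pow_self
    have : ((n : ℝ≥0∞) + 1) = (((n + 1 : ℕ) : ℝ≥0) : ℝ≥0∞) := by push_cast; rfl
    rw [this, ← ENNReal.coe_pow, ← ENNReal.coe_mul, ← ENNReal.coe_mul, ENNReal.coe_le_coe]
    calc ((n + 1 : ℕ) : ℝ≥0) * (C / s ^ (n + 1)) * (s / 4) ^ n
        ≤ 2 ^ n * (C / s ^ (n + 1)) * (s / 4) ^ n := by gcongr
      _ = C / s * (1 / 2) ^ n := by
        rw [div_pow, div_pow, one_pow, show (4 : ℝ≥0) = 2 * 2 by norm_num, mul_pow, pow_succ]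
        field_simp

/-! ### Existence -/

/-- The sum of the formal solution solves the equation. -/
lemma isAnalyticSolution_evalSeries {p : ℕ} (x₀ : ℝ) {f : smoothCircle} {R ρ : ℝ≥0}
    (hR : R ≠ 0) (hρ : ρ ≠ 0) {ε : ℝ≥0} (hε : 0 < ε) (hεR : ε ≤ R / 2) (hερ : ε ≤ ρ / 2)
    (ha : seriesNorm R ρ (formalSolution p x₀ f) ≠ ⊤)
    (hda : seriesNorm R ρ (spaceDeriv (formalSolution p x₀ f)) ≠ ⊤) :
    IsAnalyticSolution p x₀ f ε (evalSeries (formalSolution p x₀ f)) where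
  periodic t _ := periodic_evalSeries _ t
  analytic := analyticOnNhd_evalSeries hR hρ ha hε hεR hερ
  initial x := by rw [evalSeries_zero_time, coeff_zero_formalSolution]
  equation x t ht := by
    set a := formalSolution p x₀ f
    have ht' : |t| < (ρ / 2 : ℝ≥0) := (abs_lt.2 ht).trans_le (by exact_mod_cast hερ)
    have hquad : seriesNorm R ρ (a ^ (p - 1) * (spaceDeriv a * spaceDeriv a)) ≠ ⊤ :=
      seriesNorm_mul_ne_top (seriesNorm_pow_ne_top ha _) (seriesNorm_mul_ne_top hda hda)
    have hI : seriesNorm R ρ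
        (coeffwise (invDerivₗ x₀) (a ^ (p - 1) * (spaceDeriv a * spaceDeriv a))) ≠ ⊤ :=
      ne_top_of_le_ne_top (by finiteness) (seriesNorm_invDeriv_le R ρ _ x₀)
    have hI' : seriesNorm R ρ ((p / 2 : ℝ) •
        coeffwise (invDerivₗ x₀) (a ^ (p - 1) * (spaceDeriv a * spaceDeriv a))) ≠ ⊤ := by
      rw [seriesNorm_smul]
      finiteness
    have hneg : seriesNorm R ρ (-(a ^ p * spaceDeriv a)) ≠ ⊤ := by
      rw [seriesNorm_neg]
      exact seriesNorm_mul_ne_top (seriesNorm_pow_ne_top ha _) hda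
    have hF : seriesNorm R ρ (formalField p x₀ a) ≠ ⊤ :=
      ne_top_of_le_ne_top (by finiteness) (seriesNorm_add_le R ρ _ _)
    have htime := (hasDerivAt_evalSeries_time hR hρ ha hF (coeff_succ_formalSolution p x₀ f) x
      ht').deriv
    have hspace := fun y => hasDerivAt_evalSeries_space hR hρ ha hda y ht'.le
    -- The factor `p` from the chain rule leaves the nonlocal operator by linearity and joins the `1
    -- / 2` of the equation to give the `p / 2` of `formalField`.
    have hfun : (fun y => deriv (fun z => evalSeries a z t ^ p) y *
        deriv (fun z => evalSeries a z t) y) = (p : ℝ) •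
        fun y => evalSeries (a ^ (p - 1) * (spaceDeriv a * spaceDeriv a)) y t := by
      ext y
      rw [((hspace y).fun_pow p).deriv, (hspace y).deriv, Pi.smul_apply,
        evalSeries_mul hR hρ (seriesNorm_pow_ne_top ha _) (seriesNorm_mul_ne_top hda hda) y ht'.le,
        evalSeries_mul hR hρ hda hda y ht'.le, evalSeries_pow hR hρ ha _ y ht'.le, smul_eq_mul]
      ring
    rw [htime, (hspace x).deriv, hfun, invDeriv_smul, Pi.smul_apply,
      ← evalSeries_invDeriv hR hρ hquad x₀ x ht'.le, formalField,
      evalSeries_add hR hρ hneg hI' x ht'.le, evalSeries_neg, evalSeries_smul,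
      evalSeries_mul hR hρ (seriesNorm_pow_ne_top ha _) hda x ht'.le,
      evalSeries_pow hR hρ ha _ x ht'.le, smul_eq_mul]
    ring

lemma exists_isAnalyticSolution (p : ℕ) (x₀ : ℝ) {u₀ : ℝ → ℝ} (hper : Function.Periodic u₀ 1)
    (han : AnalyticOnNhd ℝ u₀ univ) :
    ∃ ε : ℝ, 0 < ε ∧ ∃ u : ℝ → ℝ → ℝ, IsAnalyticSolution p x₀ u₀ ε u := by
  let f : smoothCircle := ⟨u₀, han.contDiff, hper⟩
  obtain ⟨R, hR, hf, hdf⟩ := exists_tsum_taylorSup_ne_top f han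
  obtain ⟨ρ, hρ, ha, hda⟩ := exists_seriesNorm_formalSolution_ne_top (p := p) (x₀ := x₀) hR hf hdf
  have hε : 0 < min (R / 2) (ρ / 2) := lt_min (by positivity) (by positivity)
  exact ⟨(min (R / 2) (ρ / 2) : ℝ≥0), by exact_mod_cast hε, _,
    isAnalyticSolution_evalSeries x₀ hR hρ.ne' hε (min_le_left _ _) (min_le_right _ _) ha hda⟩

/-! ### Analytic functions on a strip -/

/-- The space-time strip `ℝ × (-ε, ε)`. -/
def strip (ε : ℝ) : Set (ℝ × ℝ) := univ ×ˢ Ioo (-ε) ε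

/-- The partial derivative in time. -/
noncomputable def timeD (W : ℝ × ℝ → ℝ) (q : ℝ × ℝ) : ℝ := fderiv ℝ W q (0, 1)

/-- The partial derivative in space. -/
noncomputable def spaceD (W : ℝ × ℝ → ℝ) (q : ℝ × ℝ) : ℝ := fderiv ℝ W q (1, 0)

section Strip

variable {ε : ℝ} {W : ℝ × ℝ → ℝ}

lemma mem_strip {x t : ℝ} : (x, t) ∈ strip ε ↔ t ∈ Ioo (-ε) ε := by simp [strip]

lemma analyticOnNhd_timeD (hW : AnalyticOnNhd ℝ W (strip ε)) :
    AnalyticOnNhd ℝ (timeD W) (strip ε) :=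
  (ContinuousLinearMap.apply ℝ ℝ ((0, 1) : ℝ × ℝ)).comp_analyticOnNhd hW.fderiv

lemma analyticOnNhd_spaceD (hW : AnalyticOnNhd ℝ W (strip ε)) :
    AnalyticOnNhd ℝ (spaceD W) (strip ε) :=
  (ContinuousLinearMap.apply ℝ ℝ ((1, 0) : ℝ × ℝ)).comp_analyticOnNhd hW.fderiv

lemma hasDerivAt_time (hW : AnalyticOnNhd ℝ W (strip ε)) (x : ℝ) {t : ℝ} (ht : t ∈ Ioo (-ε) ε) :
    HasDerivAt (fun τ => W (x, τ)) (timeD W (x, t)) t :=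
  (hW _ (mem_strip.2 ht)).differentiableAt.hasFDerivAt.comp_hasDerivAt t
    ((hasDerivAt_const t x).prodMk (hasDerivAt_id t))

lemma hasDerivAt_space (hW : AnalyticOnNhd ℝ W (strip ε)) (x : ℝ) {t : ℝ} (ht : t ∈ Ioo (-ε) ε) :
    HasDerivAt (fun y => W (y, t)) (spaceD W (x, t)) x :=
  (hW _ (mem_strip.2 ht)).differentiableAt.hasFDerivAt.comp_hasDerivAt x
    ((hasDerivAt_id x).prodMk (hasDerivAt_const x t))

lemma timeD_spaceD (hW : AnalyticOnNhd ℝ W (strip ε)) {q : ℝ × ℝ} (hq : q ∈ strip ε) :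
    timeD (spaceD W) q = spaceD (timeD W) q := by
  have hd : DifferentiableAt ℝ (fderiv ℝ W) q := (hW.fderiv q hq).differentiableAt
  have h1 : timeD (spaceD W) q = fderiv ℝ (fderiv ℝ W) q (0, 1) (1, 0) := by
    have := (hd.hasFDerivAt.clm_apply (hasFDerivAt_const ((1, 0) : ℝ × ℝ) q)).fderiv
    rw [timeD]
    erw [this]
    simp
  have h2 : spaceD (timeD W) q = fderiv ℝ (fderiv ℝ W) q (1, 0) (0, 1) := by
    have := (hd.hasFDerivAt.clm_apply (hasFDerivAt_const ((0, 1) : ℝ × ℝ) q)).fderiv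
    rw [spaceD]
    erw [this]
    simp
  rw [h1, h2]
  exact ContDiffAt.isSymmSndFDerivAt (n := 2) (hW q hq).contDiffAt (by simp) _ _

lemma analyticAt_slice (hW : AnalyticOnNhd ℝ W (strip ε)) (x : ℝ) {t : ℝ} (ht : t ∈ Ioo (-ε) ε) :
    AnalyticAt ℝ (fun τ => W (x, τ)) t :=
  (hW (x, t) (mem_strip.2 ht)).comp (analyticAt_const.prod analyticAt_id)

/-- `W` vanishes to order `k` at time zero. -/
def VanishesToOrder (k : ℕ) (W : ℝ × ℝ → ℝ) : Prop :=
  ∀ x, (k : ℕ∞) ≤ analyticOrderAt (fun t => W (x, t)) 0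

lemma zero_mem_time (hε : 0 < ε) : (0 : ℝ) ∈ Ioo (-ε) ε := ⟨by linarith, hε⟩

lemma vanishesToOrder_congr (hε : 0 < ε) {V : ℝ × ℝ → ℝ} (h : EqOn V W (strip ε)) (k : ℕ) :
    VanishesToOrder k V ↔ VanishesToOrder k W := by
  refine forall_congr' fun x => ?_
  rw [analyticOrderAt_congr]
  filter_upwards [isOpen_Ioo.mem_nhds (zero_mem_time hε)] with t ht
  exact h (mem_strip.2 ht)

/-- This recursion lets statements about the order of vanishing be proved by induction, trading one
order for one time derivative. -/
lemma vanishesToOrder_succ_iff (hε : 0 < ε) (hW : AnalyticOnNhd ℝ W (strip ε)) (k : ℕ) :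
    VanishesToOrder (k + 1) W ↔ (∀ x, W (x, 0) = 0) ∧ VanishesToOrder k (timeD W) := by
  have h0 := zero_mem_time hε
  have hderiv : ∀ x, analyticOrderAt (deriv fun t => W (x, t)) 0 =
      analyticOrderAt (fun t => timeD W (x, t)) 0 := fun x => by
    refine analyticOrderAt_congr ?_
    filter_upwards [isOpen_Ioo.mem_nhds h0] with t ht
    exact (hasDerivAt_time hW x ht).deriv
  have hzero : VanishesToOrder (k + 1) W → ∀ x, W (x, 0) = 0 := fun h x => by
    refine apply_eq_zero_of_analyticOrderAt_ne_zero (f := fun t => W (x, t)) fun h' => ?_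
    have := h x
    rw [h'] at this
    simp at this
  constructor
  · refine fun h => ⟨hzero h, fun x => ?_⟩
    rw [← hderiv, analyticOrderAt_deriv_ge_iff (analyticAt_slice hW x h0) (hzero h x)]
    exact_mod_cast h x
  · rintro ⟨hz, h⟩ x
    have := h x
    rw [← hderiv, analyticOrderAt_deriv_ge_iff (analyticAt_slice hW x h0) (hz x)] at this
    exact_mod_cast this

/-- `W (·, 0) = 0` can be differentiated in `x`, and `∂ₓ` commutes with `∂ₜ`, so the recursion
applies. -/
lemma VanishesToOrder.spaceD (hε : 0 < ε) {k : ℕ} (hW : AnalyticOnNhd ℝ W (strip ε))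
    (h : VanishesToOrder k W) : VanishesToOrder k (spaceD W) := by
  induction k generalizing W with
  | zero => intro x; simp
  | succ k ih =>
    rw [vanishesToOrder_succ_iff hε hW] at h
    rw [vanishesToOrder_succ_iff hε (analyticOnNhd_spaceD hW)]
    refine ⟨fun x => ?_, ?_⟩
    · have h1 := hasDerivAt_space hW x (zero_mem_time hε)
      simp only [h.1] at h1
      exact h1.unique (hasDerivAt_const x 0)
    · rw [vanishesToOrder_congr hε fun q hq => timeD_spaceD hW hq]
      exact ih (analyticOnNhd_timeD hW) h.2

/-- A function that vanishes to order `k` is bounded by `C |t| ^ k` on compact sets. -/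
lemma VanishesToOrder.exists_abs_le (hε : 0 < ε) {k : ℕ} (hW : AnalyticOnNhd ℝ W (strip ε))
    (h : VanishesToOrder k W) (L : ℝ) {δ : ℝ} (hδε : δ < ε) :
    ∃ C, 0 ≤ C ∧ ∀ x ∈ Icc (-L) L, ∀ t ∈ Icc (-δ) δ, |W (x, t)| ≤ C * |t| ^ k := by
  induction k generalizing W with
  | zero =>
    have hsub : Icc (-L) L ×ˢ Icc (-δ) δ ⊆ strip ε := fun q hq =>
      mem_strip.2 ⟨by linarith [hq.2.1], by linarith [hq.2.2]⟩
    obtain ⟨C, hC⟩ := (isCompact_Icc.prod isCompact_Icc).exists_bound_of_continuousOn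
      (hW.continuousOn.mono hsub)
    refine ⟨max C 0, le_max_right _ _, fun x hx t ht => ?_⟩
    rw [pow_zero, mul_one]
    exact (hC (x, t) ⟨hx, ht⟩).trans (le_max_left _ _)
  | succ k ih =>
    rw [vanishesToOrder_succ_iff hε hW] at h
    obtain ⟨C, hC0, hC⟩ := ih (analyticOnNhd_timeD hW) h.2
    refine ⟨C, hC0, fun x hx t ht => ?_⟩
    have hs : ∀ s ∈ uIcc 0 t, s ∈ Icc (-δ) δ ∧ |s| ≤ |t| := fun s hs => by
      have h2 : |s| ≤ |t| := by simpa using abs_sub_left_of_mem_uIcc hs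
      exact ⟨abs_le.1 (h2.trans (abs_le.2 ht)), h2⟩
    -- Mean value inequality in time from `0`, where `W` vanishes, to `t`: the bound on `∂ₜW` gains
    -- one factor `|t|`.
    have h1 := (convex_uIcc (0 : ℝ) t).norm_image_sub_le_of_norm_hasDerivWithin_le
      (f := fun s => W (x, s)) (f' := fun s => timeD W (x, s)) (C := C * |t| ^ k)
      (fun s hs' => (hasDerivAt_time hW x ⟨by linarith [(hs s hs').1.1],
        by linarith [(hs s hs').1.2]⟩).hasDerivWithinAt)
      (fun s hs' => (hC x hx s (hs s hs').1).trans (by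
        have := (hs s hs').2
        gcongr)) left_mem_uIcc right_mem_uIcc
    rw [h.1 x, sub_zero, sub_zero, Real.norm_eq_abs, Real.norm_eq_abs] at h1
    rwa [pow_succ, ← mul_assoc]

/-- If the order were `n < k`, then `g t = t ^ n * q t` with `q 0 ≠ 0`, whereas the bound gives `|q
t| ≤ C * |t| ^ (k - n)`, which tends to zero. -/
lemma le_analyticOrderAt_of_abs_le {g : ℝ → ℝ} {k : ℕ} (hg : AnalyticAt ℝ g 0) {C : ℝ}
    (h : ∀ᶠ t in 𝓝 0, |g t| ≤ C * |t| ^ k) : (k : ℕ∞) ≤ analyticOrderAt g 0 := by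
  by_contra! hlt
  obtain ⟨n, hn⟩ := ENat.ne_top_iff_exists.1 hlt.ne_top
  rw [← hn] at hlt
  have hnk : n < k := by exact_mod_cast hlt
  obtain ⟨q, hq, hq0, hgq⟩ := hg.analyticOrderAt_eq_natCast.1 hn.symm
  refine hq0 (abs_eq_zero.1 (le_antisymm ?_ (abs_nonneg _)))
  have h1 : Tendsto (fun t => |q t|) (𝓝[≠] 0) (𝓝 |q 0|) :=
    (hq.continuousAt.abs).tendsto.mono_left nhdsWithin_le_nhds
  have h2 : Tendsto (fun t : ℝ => C * |t| ^ (k - n)) (𝓝[≠] 0) (𝓝 0) := by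
    have : Continuous fun t : ℝ => C * |t| ^ (k - n) := by fun_prop
    have h := this.tendsto 0
    simp only [abs_zero, zero_pow (Nat.sub_pos_of_lt hnk).ne', mul_zero] at h
    exact h.mono_left nhdsWithin_le_nhds
  refine le_of_tendsto_of_tendsto h1 h2 ?_
  filter_upwards [nhdsWithin_le_nhds h, nhdsWithin_le_nhds hgq, self_mem_nhdsWithin] with t ht ht' ht0
  have htpos : 0 < |t| ^ n := pow_pos (abs_pos.2 ht0) n
  rw [ht', sub_zero, smul_eq_mul, abs_mul, abs_pow] at ht
  rw [← mul_le_mul_iff_right₀ htpos]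
  calc |t| ^ n * |q t| ≤ C * |t| ^ k := ht
    _ = |t| ^ n * (C * |t| ^ (k - n)) := by
      rw [mul_left_comm, ← pow_add, Nat.add_sub_cancel' hnk.le]

lemma eq_zero_of_forall_vanishesToOrder (hε : 0 < ε) (hW : AnalyticOnNhd ℝ W (strip ε))
    (h : ∀ k, VanishesToOrder k W) {x t : ℝ} (ht : t ∈ Ioo (-ε) ε) : W (x, t) = 0 := by
  have htop : analyticOrderAt (fun t => W (x, t)) 0 = ⊤ :=
    ENat.eq_top_iff_forall_ge.2 fun k => h k x
  exact AnalyticOnNhd.eqOn_zero_of_preconnected_of_eventuallyEq_zero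
    (f := fun t => W (x, t)) (U := Ioo (-ε) ε) (fun s hs => analyticAt_slice hW x hs)
    isPreconnected_Ioo (zero_mem_time hε) (analyticOrderAt_eq_top.1 htop) ht

end Strip

/-! ### Uniqueness -/

lemma exists_lipschitz_of_contDiff {Φ : ℝ × ℝ → ℝ} (hΦ : ContDiff ℝ 1 Φ) (B : ℝ) :
    ∃ K, 0 ≤ K ∧ ∀ y ∈ Icc (-B) B ×ˢ Icc (-B) B, ∀ z ∈ Icc (-B) B ×ˢ Icc (-B) B,
      |Φ y - Φ z| ≤ K * max |y.1 - z.1| |y.2 - z.2| := by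
  obtain ⟨K, hK⟩ := (hΦ.locallyLipschitz.locallyLipschitzOn (s := Icc (-B) B ×ˢ Icc (-B) B)
    ).exists_lipschitzOnWith_of_compact (isCompact_Icc.prod isCompact_Icc)
  exact ⟨K, K.2, fun y hy z hz => hK.dist_le_mul y hy z hz⟩

section Uniqueness

variable {p : ℕ} {x₀ ε : ℝ} {u₀ : ℝ → ℝ} {u v : ℝ → ℝ → ℝ}

/-- The function `(x, t) ↦ u x t` of a point of space-time. -/
abbrev uncurried (u : ℝ → ℝ → ℝ) (q : ℝ × ℝ) : ℝ := u q.1 q.2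

/-- The quadratic term `∂ₓ (u ^ p) ∂ₓ u` of the equation at time `t`. -/
noncomputable abbrev quadraticTerm (p : ℕ) (u : ℝ → ℝ → ℝ) (t y : ℝ) : ℝ :=
  deriv (fun z => u z t ^ p) y * deriv (fun z => u z t) y

lemma IsAnalyticSolution.quadraticTerm_eq (hu : IsAnalyticSolution p x₀ u₀ ε u) {t : ℝ}
    (ht : t ∈ Ioo (-ε) ε) (y : ℝ) :
    quadraticTerm p u t y = p * u y t ^ (p - 1) * spaceD (uncurried u) (y, t) ^ 2 := by
  have h := hasDerivAt_space hu.analytic y ht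
  have h1 : deriv (fun z => u z t) y = spaceD (uncurried u) (y, t) := h.deriv
  have h2 : deriv (fun z => u z t ^ p) y = p * u y t ^ (p - 1) * spaceD (uncurried u) (y, t) :=
    (h.fun_pow p).deriv
  rw [quadraticTerm, h1, h2]
  ring

lemma IsAnalyticSolution.continuous_quadraticTerm (hu : IsAnalyticSolution p x₀ u₀ ε u) {t : ℝ}
    (ht : t ∈ Ioo (-ε) ε) : Continuous (quadraticTerm p u t) := by
  have hslice : ∀ {W : ℝ × ℝ → ℝ}, AnalyticOnNhd ℝ W (strip ε) → Continuous fun y => W (y, t) :=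
    fun hW => hW.continuousOn.comp_continuous (by fun_prop) fun y => mem_strip.2 ht
  have h1 := hslice hu.analytic
  have h2 := hslice (analyticOnNhd_spaceD hu.analytic)
  rw [funext (hu.quadraticTerm_eq ht)]
  exact (continuous_const.mul (h1.pow _)).mul (h2.pow 2)

lemma IsAnalyticSolution.periodic_quadraticTerm (hu : IsAnalyticSolution p x₀ u₀ ε u) {t : ℝ}
    (ht : t ∈ Ioo (-ε) ε) : Function.Periodic (quadraticTerm p u t) 1 := by
  have h1 := hu.periodic t ht
  have h2 : Function.Periodic (fun z => u z t ^ p) 1 := fun z =>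
    congrArg (· ^ p) (h1 z)
  exact (periodic_deriv h2).mul (periodic_deriv h1)

lemma IsAnalyticSolution.timeD_eq (hu : IsAnalyticSolution p x₀ u₀ ε u) {t : ℝ}
    (ht : t ∈ Ioo (-ε) ε) (x : ℝ) :
    timeD (uncurried u) (x, t) = 1 / 2 * invDeriv x₀ (quadraticTerm p u t) x -
      u x t ^ p * spaceD (uncurried u) (x, t) := by
  have h1 : deriv (fun τ => u x τ) t = timeD (uncurried u) (x, t) :=
    (hasDerivAt_time hu.analytic x ht).deriv
  have h2 : deriv (fun z => u z t) x = spaceD (uncurried u) (x, t) :=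
    (hasDerivAt_space hu.analytic x ht).deriv
  have h := hu.equation x t ht
  rw [h1, h2] at h
  exact eq_sub_of_add_eq h

/-- If the difference of two solutions vanishes to order `k`, so does its time derivative. -/
lemma vanishesToOrder_timeD_sub (hε : 0 < ε) (hu : IsAnalyticSolution p x₀ u₀ ε u)
    (hv : IsAnalyticSolution p x₀ u₀ ε v) {k : ℕ}
    (h : VanishesToOrder k (uncurried v - uncurried u)) :
    VanishesToOrder k (timeD (uncurried v - uncurried u)) := by
  have hW : AnalyticOnNhd ℝ (uncurried v - uncurried u) (strip ε) := hv.analytic.sub hu.analytic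
  have hsub : ∀ {q}, q ∈ strip ε → fderiv ℝ (uncurried v - uncurried u) q =
      fderiv ℝ (uncurried v) q - fderiv ℝ (uncurried u) q := fun hq =>
    fderiv_sub (hv.analytic _ hq).differentiableAt (hu.analytic _ hq).differentiableAt
  intro x
  -- The interval `[-L, L]` contains both `x` and the period `[0, 1]`, whose values enter the
  -- nonlocal term at `x`.
  set L := |x| + 1 with hL
  set δ := ε / 2 with hδ
  have hδε : δ < ε := half_lt_self hε
  have hx : x ∈ Icc (-L) L := abs_le.1 (by linarith)
  have hunit : Icc (0 : ℝ) 1 ⊆ Icc (-L) L := fun y hy =>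
    ⟨by linarith [hy.1, abs_nonneg x], by linarith [hy.2, abs_nonneg x]⟩
  have hbound : ∀ {V : ℝ × ℝ → ℝ}, AnalyticOnNhd ℝ V (strip ε) →
      ∃ C, ∀ y ∈ Icc (-L) L, ∀ t ∈ Icc (-δ) δ, |V (y, t)| ≤ C := fun hV => by
    obtain ⟨C, -, hC⟩ := VanishesToOrder.exists_abs_le (k := 0) hε hV (by intro y; simp) L hδε
    exact ⟨C, by simpa using hC⟩
  obtain ⟨B₁, hB₁⟩ := hbound hu.analytic
  obtain ⟨B₂, hB₂⟩ := hbound hv.analytic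
  obtain ⟨B₃, hB₃⟩ := hbound (analyticOnNhd_spaceD hu.analytic)
  obtain ⟨B₄, hB₄⟩ := hbound (analyticOnNhd_spaceD hv.analytic)
  set B := max (max B₁ B₂) (max B₃ B₄) with hB
  have hmem_u : ∀ y ∈ Icc (-L) L, ∀ t ∈ Icc (-δ) δ,
      (u y t, spaceD (uncurried u) (y, t)) ∈ Icc (-B) B ×ˢ Icc (-B) B := fun y hy t ht =>
    ⟨abs_le.1 ((hB₁ y hy t ht).trans ((le_max_left _ _).trans (le_max_left _ _))),
      abs_le.1 ((hB₃ y hy t ht).trans ((le_max_left _ _).trans (le_max_right _ _)))⟩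
  have hmem_v : ∀ y ∈ Icc (-L) L, ∀ t ∈ Icc (-δ) δ,
      (v y t, spaceD (uncurried v) (y, t)) ∈ Icc (-B) B ×ˢ Icc (-B) B := fun y hy t ht =>
    ⟨abs_le.1 ((hB₂ y hy t ht).trans ((le_max_right _ _).trans (le_max_left _ _))),
      abs_le.1 ((hB₄ y hy t ht).trans ((le_max_right _ _).trans (le_max_right _ _)))⟩
  obtain ⟨K, hK0, hK⟩ := exists_lipschitz_of_contDiff
    (Φ := fun y : ℝ × ℝ => y.1 ^ p * y.2) (by fun_prop) B
  obtain ⟨K', hK'0, hK'⟩ := exists_lipschitz_of_contDiff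
    (Φ := fun y : ℝ × ℝ => p * y.1 ^ (p - 1) * y.2 ^ 2) (by fun_prop) B
  obtain ⟨C, hC0, hC⟩ := h.exists_abs_le hε hW L hδε
  obtain ⟨C', hC'0, hC'⟩ := (h.spaceD hε hW).exists_abs_le hε (analyticOnNhd_spaceD hW) L hδε
  have htime : ∀ {t}, t ∈ Icc (-δ) δ → t ∈ Ioo (-ε) ε := fun ht =>
    ⟨by linarith [ht.1], by linarith [ht.2]⟩
  have hmax : ∀ y ∈ Icc (-L) L, ∀ t ∈ Icc (-δ) δ, max |v y t - u y t|
      |spaceD (uncurried v) (y, t) - spaceD (uncurried u) (y, t)| ≤ max C C' * |t| ^ k := by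
    intro y hy t ht
    have h2 := hC' y hy t ht
    rw [spaceD, hsub (mem_strip.2 (htime ht))] at h2
    refine max_le ((hC y hy t ht).trans ?_) (h2.trans ?_)
    · gcongr; exact le_max_left _ _
    · gcongr; exact le_max_right _ _
  -- `K` comes from the transport term; `K'` comes from the nonlocal term, where the factor `1 / 2`
  -- cancels the bound 2 of `∂ₓ⁻¹`.
  refine le_analyticOrderAt_of_abs_le (analyticAt_slice (analyticOnNhd_timeD hW) x
    (zero_mem_time hε)) (C := (K' + K) * max C C') ?_
  filter_upwards [Icc_mem_nhds (by linarith : -δ < 0) (by linarith : 0 < δ)] with t ht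
  have ht' := htime ht
  have hquad : ∀ y ∈ Icc (0 : ℝ) 1, |(quadraticTerm p v t - quadraticTerm p u t) y| ≤
      K' * (max C C' * |t| ^ k) := fun y hy => by
    rw [Pi.sub_apply, hv.quadraticTerm_eq ht', hu.quadraticTerm_eq ht']
    refine (hK' _ (hmem_v y (hunit hy) t ht) _ (hmem_u y (hunit hy) t ht)).trans ?_
    exact mul_le_mul_of_nonneg_left (hmax y (hunit hy) t ht) hK'0
  have hinv := abs_invDeriv_le
    ((hv.continuous_quadraticTerm ht').sub (hu.continuous_quadraticTerm ht'))
    ((hv.periodic_quadraticTerm ht').sub (hu.periodic_quadraticTerm ht')) hquad x₀ x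
  rw [invDeriv_sub (hv.continuous_quadraticTerm ht') (hu.continuous_quadraticTerm ht'),
    Pi.sub_apply] at hinv
  have htrans := (hK _ (hmem_v x hx t ht) _ (hmem_u x hx t ht)).trans
    (mul_le_mul_of_nonneg_left (hmax x hx t ht) hK0)
  have hdecomp : timeD (uncurried v - uncurried u) (x, t) =
      1 / 2 * (invDeriv x₀ (quadraticTerm p v t) x - invDeriv x₀ (quadraticTerm p u t) x) -
      (v x t ^ p * spaceD (uncurried v) (x, t) - u x t ^ p * spaceD (uncurried u) (x, t)) := by
    have h1 : timeD (uncurried v - uncurried u) (x, t) =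
        timeD (uncurried v) (x, t) - timeD (uncurried u) (x, t) := by
      rw [timeD, hsub (mem_strip.2 ht')]
      rfl
    rw [h1, hv.timeD_eq ht', hu.timeD_eq ht']
    ring
  rw [hdecomp]
  refine (abs_sub _ _).trans ?_
  rw [abs_mul, abs_of_pos (by norm_num : (0 : ℝ) < 1 / 2)]
  linarith

/-- Two analytic solutions with the same initial value coincide. -/
lemma IsAnalyticSolution.eq (hε : 0 < ε) (hu : IsAnalyticSolution p x₀ u₀ ε u)
    (hv : IsAnalyticSolution p x₀ u₀ ε v) (x : ℝ) {t : ℝ} (ht : t ∈ Ioo (-ε) ε) :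
    v x t = u x t := by
  have hW : AnalyticOnNhd ℝ (uncurried v - uncurried u) (strip ε) := hv.analytic.sub hu.analytic
  refine sub_eq_zero.1 (eq_zero_of_forall_vanishesToOrder (W := uncurried v - uncurried u) hε hW
    (fun k => ?_) (x := x) ht)
  induction k with
  | zero => intro y; simp
  | succ k ih =>
    rw [vanishesToOrder_succ_iff hε hW]
    refine ⟨fun y => ?_, vanishesToOrder_timeD_sub hε hu hv ih⟩
    simp [uncurried, hu.initial, hv.initial]

end Uniqueness

end ModifiedHunterSaxton

theorem mainTheorem3 (p : ℕ) (hp : 1 ≤ p) (x₀ : ℝ) (u₀ : ℝ → ℝ)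
    (hper : Function.Periodic u₀ 1) (han : AnalyticOnNhd ℝ u₀ Set.univ) :
    ∃ ε : ℝ, 0 < ε ∧ ∃ u : ℝ → ℝ → ℝ,
      ModifiedHunterSaxton.IsAnalyticSolution p x₀ u₀ ε u ∧
      ∀ v : ℝ → ℝ → ℝ, ModifiedHunterSaxton.IsAnalyticSolution p x₀ u₀ ε v →
        ∀ x : ℝ, ∀ t ∈ Set.Ioo (-ε) ε, v x t = u x t := by
  obtain ⟨ε, hε, u, hu⟩ := ModifiedHunterSaxton.exists_isAnalyticSolution p x₀ hper han
  exact ⟨ε, hε, u, hu, fun v hv x t ht => hu.eq hε hv x ht⟩
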